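/- Let $(\boldsymbol{x},y)$ have a joint probability law on $\mathcal X\times\{-1,+1\}$, with class priors $\pi_\pm=p(y=\pm1)$, $\pi_+\neq\frac12$, and class-conditional laws $p_\pm$. Put $$\widetilde p_+=\frac{\pi_+p_++\pi_-^2p_-}{\pi_-^2+\pi_+},\qquad \widetilde p_-=\frac{\pi_+^2p_++\pi_-p_-}{\pi_+^2+\pi_-}.$$ Let $\ell:\mathbb R\times\{-1,+1\}\to[0,\infty)$ be a loss with $|\ell(z,y)-\ell(z',y)|\le L_\ell|z-z'|$, and let $R(g)=\mathbb E[\ell(g(\boldsymbol{x}),y)]$. Let $\mathcal G$ be a class of measurable functions $g:\mathcal X\to\mathbb R$ that contains a countable subset of which every element of $\mathcal G$ is a pointwise limit of a sequence, with $\sup_{g\in\mathcal G}\|g\|_\infty\le C_g$ and $\sup_{|z|\le C_g}\ell(z,y)\le C_\ell$. Let $C_{\mathcal G}$ be a constant such that, for all $n\ge1$ and for $\mu\in\{\widetilde p_+,\widetilde p_-\}$, the Rademacher complexity satisfies $$\mathfrak R(\mathcal G;n,\mu)=\mathbb E_{\boldsymbol{x}_1,\dots,\boldsymbol{x}_n\sim\mu}\,\mathbb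 E_{\boldsymbol\sigma}\Bigl[\sup_{g\in\mathcal G}\frac1n\sum_{i=1}^n\sigma_ig(\boldsymbol{x}_i)\Bigr]\le \frac{C_{\mathcal G}}{\sqrt n},$$ where $\sigma_1,\dots,\sigma_n$ are independent and uniform on $\{-1,+1\}$. Let $g^*$ minimize $R$ over $\mathcal G$. Let $n_{\mathrm S},n_{\mathrm D}\ge1$. Let the similar pairs $(\boldsymbol{x}^+_{\mathrm S,i},\boldsymbol{x}^-_{\mathrm S,i})$, $i\le n_{\mathrm S}$, be i.i.d., and let the dissimilar pairs $(\boldsymbol{x}^+_{\mathrm D,i},\boldsymbol{x}^-_{\mathrm D,i})$, $i\le n_{\mathrm D}$, be i.i.d., where in every pair the first instance has law $\widetilde p_+$ and the second has law $\widetilde p_-$. For $\bar\pi_+\in[0,1]$ with $\bar\pi_+\ne\frac12$ and $\bar\pi_-=1-\bar\pi_+$, let $$\widehat R^{\bar\pi}(g)=\sum_{A\in\{\mathrm S,\mathrm D\}}\ \sum_{t\in\{+,-\}}\frac1{n_A}\sum_{i=1}^{n_A}\bar{\boldsymbol\alpha}^{A}_t\begin{pmatrix}\ell(g(\boldsymbol{x}^t_{A,i}),+1)\\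 \ell(g(\boldsymbol{x}^t_{A,i}),-1)\end{pmatrix},$$ $$\bar{\boldsymbol\alpha}^{\mathrm S}_t=\frac{\bar\pi_t^2}{\bar\pi_+-\bar\pi_-}(\bar\pi_+,-\bar\pi_-),\qquad \bar{\boldsymbol\alpha}^{\mathrm D}_t=\frac{1}{\bar\pi_+-\bar\pi_-}\bigl(\bar\pi_-(\bar\pi_t^2-\bar\pi_{-t}),\ \bar\pi_+(\bar\pi_{-t}-\bar\pi_t^2)\bigr).$$ Then for every $\delta>0$, with probability at least $1-\delta$, simultaneously for all such $\bar\pi_+$ (which may therefore be estimated from the data) and all minimizers $\hat g_{\bar\pi}$ of $\widehat R^{\bar\pi}$ over $\mathcal G$, $$R(\hat g_{\bar\pi})-R(g^*)\le 2C_{\mathcal G,\ell,\delta}\left(\frac{\pi_+^2+\pi_-^2}{\sqrt{2n_{\mathrm S}}}+\frac{|\pi_+^2-\pi_-|+|\pi_+-\pi_-^2|}{\sqrt{2n_{\mathrm D}}}\right)+\frac{2C_\ell(C_{\mathrm{S\text{-}PC}}+C_{\mathrm{D\text{-}PC}})|\bar\pi_+-\pi_+|}{|\bar\pi_+-\bar\pi_-||\pi_+-\pi_-|},$$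 where $$C_{\mathcal G,\ell,\delta}=\frac{4L_\ell C_{\mathcal G}+2C_\ell\sqrt{\log(4/\delta)}}{|\pi_+-\pi_-|}$$ (for $\delta\ge1$ there is nothing to show) and $$\begin{aligned} C_{\mathrm{S\text{-}PC}}={}&|2\bar\pi_+\pi_+(\bar\pi_++\pi_+)-\bar\pi_+^2-\bar\pi_+\pi_+-\pi_+^2|+|\bar\pi_+\pi_+(1-\bar\pi_--\pi_-)+\bar\pi_-\pi_-(\bar\pi_++\pi_+)|\\ &+|\bar\pi_-\pi_-(1-\bar\pi_+-\pi_+)+\bar\pi_+\pi_+(\bar\pi_-+\pi_-)|+|2\bar\pi_-\pi_-(\bar\pi_-+\pi_-)-\bar\pi_-^2-\bar\pi_-\pi_--\pi_-^2|,\\ C_{\mathrm{D\text{-}PC}}={}&|(\bar\pi_++\pi_+)(1-\bar\pi_+\pi_+-\bar\pi_-\pi_-)-\bar\pi_+\pi_+|+|\bar\pi_+^2+\pi_+^2-2\bar\pi_+\pi_+(\bar\pi_++\pi_+)-\bar\pi_-\pi_-|\\ &+|\bar\pi_-^2+\pi_-^2-2\bar\pi_-\pi_-(\bar\pi_-+\pi_-)-\bar\pi_+\pi_+|+|(\bar\pi_-+\pi_-)(1-\bar\pi_+\pi_+-\bar\pi_-\pi_-)-\bar\pi_-\pi_-|.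 \end{aligned}$$ -/

import Mathlib

open MeasureTheory ProbabilityTheory Filter Topology

namespace SDPcomp

noncomputable section

/-! Labels `+1` and `-1` are the two elements of `ℤˣ`. -/

instance : MeasurableSingletonClass ℤˣ :=
  ⟨fun y => ⟨{(y : ℤ)}, trivial, by ext u; simp [Units.ext_iff]⟩⟩

/-- The vector of class priors `(π_+, π_-)` determined by the value `p = π_+`. -/
def prior (p : ℝ) (t : ℤˣ) : ℝ := if t = 1 then p else 1 - p

section Population

variable {𝒳 : Type*} [MeasurableSpace 𝒳]

/-- The positive class prior `π_+ = p(y = +1)` of a joint law of `(x, y)`. -/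
def posPrior (D : Measure (𝒳 × ℤˣ)) : ℝ := D.real (Prod.snd ⁻¹' {1})

/-- The class-conditional law `p(x | y)`. -/
def classCond (D : Measure (𝒳 × ℤˣ)) (y : ℤˣ) : Measure 𝒳 :=
  (cond D (Prod.snd ⁻¹' {y})).map Prod.fst

/-- The Pcomp laws: `pcompLaw D 1` is the law of the instance that the comparison ranks first,
`(π_+ p_+ + π_-² p_-) / (π_-² + π_+)`, and `pcompLaw D (-1)` that of the instance ranked second,
`(π_+² p_+ + π_- p_-) / (π_+² + π_-)`. -/
def pcompLaw (D : Measure (𝒳 × ℤˣ)) (t : ℤˣ) : Measure 𝒳 :=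
  let π := prior (posPrior D)
  ENNReal.ofReal (π t / (π (-t) ^ 2 + π t)) • classCond D t +
    ENNReal.ofReal (π (-t) ^ 2 / (π (-t) ^ 2 + π t)) • classCond D (-t)

/-- The classification risk `R(g) = E_{p(x,y)} [ℓ(g(x), y)]`. -/
def risk (D : Measure (𝒳 × ℤˣ)) (loss : ℝ → ℤˣ → ℝ) (g : 𝒳 → ℝ) : ℝ :=
  ∫ z, loss (g z.1) z.2 ∂D

/-- `X 0, …, X (n-1)` are i.i.d. pairs `(x^+, x^-)` whose first and second components follow the two
Pcomp laws; the dependence between the two components of one pair is arbitrary. -/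
structure IsPcompSample {Ω : Type*} [MeasurableSpace Ω] (D : Measure (𝒳 × ℤˣ)) (P : Measure Ω)
    {n : ℕ} (X : Fin n → Ω → 𝒳 × 𝒳) : Prop where
  measurable : ∀ i, Measurable (X i)
  indep : iIndepFun X P
  identDistrib : ∀ i j, IdentDistrib (X i) (X j) P P
  law_fst : ∀ i, P.map (fun ω => (X i ω).1) = pcompLaw D 1
  law_snd : ∀ i, P.map (fun ω => (X i ω).2) = pcompLaw D (-1)

/-- Rademacher complexity
`E_{x_1, …, x_n ∼ μ} E_σ [sup_{g ∈ 𝒢} (1/n) ∑ σ_i g(x_i)]`, with `σ` uniform on `{+1,-1}^n`. -/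
def rademacherComplexity (𝒢 : Set (𝒳 → ℝ)) (n : ℕ) (μ : Measure 𝒳) : ℝ :=
  ∫ x : Fin n → 𝒳, (1 / 2 ^ n : ℝ) *
    ∑ σ : Fin n → ℤˣ, ⨆ g : 𝒢, (1 / n : ℝ) * ∑ i, ((σ i : ℤ) : ℝ) * (g : 𝒳 → ℝ) (x i)
    ∂(Measure.pi fun _ => μ)

end Population

section Estimator

variable {𝒳 : Type*}

/-- A countable subclass is dense in `𝒢` for pointwise convergence of sequences (the usual
condition under which suprema over `𝒢` are measurable). -/
def PointwiseSeparable (𝒢 : Set (𝒳 → ℝ)) : Prop :=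
  ∃ 𝒢₀ ⊆ 𝒢, 𝒢₀.Countable ∧
    ∀ g ∈ 𝒢, ∃ u : ℕ → 𝒳 → ℝ, (∀ k, u k ∈ 𝒢₀) ∧
      ∀ x, Tendsto (fun k => u k x) atTop (𝓝 (g x))

/-- The coefficient vector `α^S_t`, for the value `p` of the positive class prior. -/
def alphaS (p : ℝ) (t : ℤˣ) : ℝ × ℝ :=
  let π := prior p
  (π t ^ 2 / (π 1 - π (-1))) • (π 1, -π (-1))

/-- The coefficient vector `α^D_t`, for the value `p` of the positive class prior. -/
def alphaD (p : ℝ) (t : ℤˣ) : ℝ × ℝ :=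
  let π := prior p
  (1 / (π 1 - π (-1))) • (π (-1) * (π t ^ 2 - π (-t)), π 1 * (π (-t) - π t ^ 2))

/-- The component `x^+` or `x^-` of a pair. -/
def component (t : ℤˣ) (z : 𝒳 × 𝒳) : 𝒳 := if t = 1 then z.1 else z.2

/-- `∑_t (1/n) ∑_i α_t · (ℓ(g(x_i^t), +1), ℓ(g(x_i^t), -1))`. -/
def weightedEmpRisk (α : ℤˣ → ℝ × ℝ) (loss : ℝ → ℤˣ → ℝ) {n : ℕ} (z : Fin n → 𝒳 × 𝒳)
    (g : 𝒳 → ℝ) : ℝ :=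
  ∑ t : ℤˣ, (1 / n : ℝ) * ∑ i,
    ((α t).1 * loss (g (component t (z i))) 1 + (α t).2 * loss (g (component t (z i))) (-1))

/-- The SD-Pcomp empirical risk computed with the value `p` of the positive class prior from
the similar pairs `zS` and the dissimilar pairs `zD`. -/
def empRisk (p : ℝ) (loss : ℝ → ℤˣ → ℝ) {nS nD : ℕ} (zS : Fin nS → 𝒳 × 𝒳)
    (zD : Fin nD → 𝒳 × 𝒳) (g : 𝒳 → ℝ) : ℝ :=
  weightedEmpRisk (alphaS p) loss zS g + weightedEmpRisk (alphaD p) loss zD g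

end Estimator

/-- `C_{𝒢,ℓ,δ}`, for the value `p` of the positive class prior. -/
def constGLD (p L CG Cl δ : ℝ) : ℝ :=
  (4 * L * CG + 2 * Cl * √(Real.log (4 / δ))) / |prior p 1 - prior p (-1)|

/-- The sample-error term, for the value `p` of the positive class prior. -/
def sampleError (p L CG Cl δ : ℝ) (nS nD : ℕ) : ℝ :=
  let a := prior p 1
  let b := prior p (-1)
  constGLD p L CG Cl δ *
    ((a ^ 2 + b ^ 2) / √(2 * nS) + (|a ^ 2 - b| + |a - b ^ 2|) / √(2 * nD))

/-- `C_{S-PC}`, for the true positive prior `p` and the substituted value `q`. -/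
def constS (p q : ℝ) : ℝ :=
  let a := prior p 1
  let b := prior p (-1)
  let a' := prior q 1
  let b' := prior q (-1)
  |2 * a' * a * (a' + a) - a' ^ 2 - a' * a - a ^ 2|
    + |a' * a * (1 - b' - b) + b' * b * (a' + a)|
    + |b' * b * (1 - a' - a) + a' * a * (b' + b)|
    + |2 * b' * b * (b' + b) - b' ^ 2 - b' * b - b ^ 2|

/-- `C_{D-PC}`, for the true positive prior `p` and the substituted value `q`. -/
def constD (p q : ℝ) : ℝ :=
  let a := prior p 1
  let b := prior p (-1)
  let a' := prior q 1
  let b' := prior q (-1)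
  |(a' + a) * (1 - a' * a - b' * b) - a' * a|
    + |a' ^ 2 + a ^ 2 - 2 * a' * a * (a' + a) - b' * b|
    + |b' ^ 2 + b ^ 2 - 2 * b' * b * (b' + b) - a' * a|
    + |(b' + b) * (1 - a' * a - b' * b) - b' * b|

/-- The bias term caused by using `q` in place of the true positive prior `p`. -/
def priorBias (p q Cl : ℝ) : ℝ :=
  2 * (Cl * (constS p q + constD p q) * |q - p| /
    (|prior q 1 - prior q (-1)| * |prior p 1 - prior p (-1)|))

end

end SDPcomp

open SDPcomp

/-! With the true priors the empirical risk is an unbiased estimate of `R`: both components of each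
vector `α_t` share a scalar factor, so the similar pairs see only the loss `lossS` and the
dissimilar pairs only `lossD`, and comparing coefficients of the class-conditional integrals gives
`risk_eq_pcomp`. As the coefficients enter linearly, it suffices to control four empirical means
(similar or dissimilar, first or second instance) uniformly over `𝒢`. Within one such mean the
instances are i.i.d.; dependence between the samples is harmless because they are combined by a
union bound.

Each mean is handled by McDiarmid's inequality, symmetrization and Talagrand's contraction. The two
mixed losses are still `L`-Lipschitz and have oscillation at most `Cl`, since the weights `p` and `1
- p` are nonnegative with sum one. Pointwise separability replaces `𝒢` by a sequence, which settles
measurability.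

Replacing the true prior `p` by `q` changes the empirical risk by at most `Cl` times the `ℓ¹`
distance of the coefficient vectors, and every coefficient difference has the factor `q - p`. This
bound holds for every sample, so the good event does not depend on `q`, and `q` may be chosen from
the data. The usual comparison of an empirical minimizer with `gstar` then pays the deviation and
the bias twice each. -/

namespace SDPcomp

/-! ### Concentration: Hoeffding's lemma and McDiarmid's inequality. -/

section BoundedDifferences

variable {𝒳 : Type*} [MeasurableSpace 𝒳]

/-- A bounded measurable real function is integrable for a finite measure. -/
lemma integrable_of_abs_le {μ : Measure 𝒳} [IsFiniteMeasure μ] {f : 𝒳 → ℝ} (hf : Measurable f)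
    {B : ℝ} (hB : ∀ x, |f x| ≤ B) : Integrable f μ :=
  Integrable.of_bound hf.aestronglyMeasurable B (ae_of_all _ hB)

lemma integrable_exp_mul_of_abs_le {μ : Measure 𝒳} [IsFiniteMeasure μ] {f : 𝒳 → ℝ}
    (hf : Measurable f) {B : ℝ} (hB : ∀ x, |f x| ≤ B) (s : ℝ) :
    Integrable (fun x => Real.exp (s * f x)) μ := by
  refine integrable_of_abs_le (B := Real.exp (|s| * B)) (by fun_prop) fun x => ?_
  rw [abs_of_pos (Real.exp_pos _)]
  refine Real.exp_le_exp.2 ((le_abs_self _).trans ?_)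
  rw [abs_mul]
  exact mul_le_mul_of_nonneg_left (hB x) (abs_nonneg s)

/-- **Hoeffding's lemma** for a function of oscillation at most `c`. -/
lemma integral_exp_mul_le_of_oscillation {μ : Measure 𝒳} [IsProbabilityMeasure μ] {f : 𝒳 → ℝ}
    (hf : Measurable f) {c : ℝ} (hc : 0 ≤ c) (hd : ∀ x y, f y ≤ f x + c) (s : ℝ) :
    ∫ x, Real.exp (s * f x) ∂μ ≤ Real.exp (s * ∫ x, f x ∂μ + c ^ 2 * s ^ 2 / 8) := by
  obtain ⟨x₀⟩ := nonempty_of_isProbabilityMeasure μ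
  have : Nonempty 𝒳 := ⟨x₀⟩
  have hbdd : BddBelow (Set.range f) := by
    refine ⟨f x₀ - c, ?_⟩
    rintro _ ⟨y, rfl⟩
    linarith [hd y x₀]
  have hmem : ∀ x, f x ∈ Set.Icc (⨅ y, f y) ((⨅ y, f y) + c) := fun x =>
    ⟨ciInf_le hbdd x, by
      have : f x - c ≤ ⨅ y, f y := le_ciInf fun y => by linarith [hd y x]
      linarith⟩
  have h := (hasSubgaussianMGF_of_mem_Icc (μ := μ) hf.aemeasurable (ae_of_all _ hmem)).mgf_le s
  have hcoe : ((((‖(⨅ y, f y) + c - ⨅ y, f y‖₊ / 2) ^ 2 : NNReal)) : ℝ) = c ^ 2 / 4 := by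
    rw [add_sub_cancel_left]
    push_cast
    rw [Real.norm_of_nonneg hc]
    ring
  rw [hcoe, mgf] at h
  have hsplit : ∀ x, Real.exp (s * f x)
      = Real.exp (s * ∫ x, f x ∂μ) * Real.exp (s * (f x - ∫ x, f x ∂μ)) := fun x => by
    rw [← Real.exp_add]
    congr 1
    ring
  simp_rw [hsplit]
  rw [integral_const_mul, Real.exp_add]
  refine mul_le_mul_of_nonneg_left (h.trans (le_of_eq ?_)) (Real.exp_pos _).le
  congr 1
  ring

/-- Moment generating function form of **McDiarmid's inequality**. -/
lemma integral_exp_mul_le_of_bounded_differences (μ : Measure 𝒳) [IsProbabilityMeasure μ]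
    {c : ℝ} (hc : 0 ≤ c) {B : ℝ} (s : ℝ) {n : ℕ} (F : (Fin n → 𝒳) → ℝ) (hF : Measurable F)
    (hB : ∀ x, |F x| ≤ B) (hd : ∀ x i y, F (Function.update x i y) ≤ F x + c) :
    ∫ x, Real.exp (s * F x) ∂(Measure.pi fun _ => μ) ≤
      Real.exp (s * ∫ x, F x ∂(Measure.pi fun _ => μ) + n * (c ^ 2 * s ^ 2 / 8)) := by
  induction n with
  | zero =>
    have h : ∀ x, F x = F default := fun x => by rw [Subsingleton.elim x default]
    simp_rw [h]
    simp
  | succ n ih =>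
    set ν : Measure (Fin n → 𝒳) := Measure.pi fun _ => μ with hν
    have hmp := (measurePreserving_piFinSuccAbove (fun _ : Fin (n + 1) => μ) 0).symm
    have hcons : ∀ y : 𝒳 × (Fin n → 𝒳),
        (MeasurableEquiv.piFinSuccAbove (fun _ => 𝒳) 0).symm y = Fin.cons y.1 y.2 := fun y => by
      simp [MeasurableEquiv.piFinSuccAbove_symm_apply, Fin.insertNthEquiv]
    have hmcons : Measurable fun y : 𝒳 × (Fin n → 𝒳) =>
        (Fin.cons y.1 y.2 : Fin (n + 1) → 𝒳) := by
      simp_rw [← hcons]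
      exact MeasurableEquiv.measurable _
    have hint : ∀ f : (Fin (n + 1) → 𝒳) → ℝ, ∫ x, f x ∂(Measure.pi fun _ => μ)
        = ∫ y, f (Fin.cons y.1 y.2) ∂(μ.prod ν) := fun f => by
      rw [← hmp.integral_comp']
      simp_rw [hcons]
      rfl
    have hFc : Measurable fun y : 𝒳 × (Fin n → 𝒳) => F (Fin.cons y.1 y.2) := hF.comp hmcons
    -- Averaging out the first coordinate keeps the bound `B` and the differences `c`, so the
    -- induction hypothesis applies to `H`; Hoeffding's lemma on the first coordinate pays one
    -- factor `exp (c² s² / 8)`.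
    set H : (Fin n → 𝒳) → ℝ := fun x => ∫ y, F (Fin.cons y x) ∂μ with hH
    have hHm : Measurable H := by
      have : Measurable fun p : (Fin n → 𝒳) × 𝒳 => F (Fin.cons p.2 p.1) :=
        hFc.comp measurable_swap
      exact this.stronglyMeasurable.integral_prod_right'.measurable
    have hsec : ∀ x, Measurable fun y => F (Fin.cons y x) := fun x =>
      hFc.comp measurable_prodMk_right
    have hseci : ∀ x, Integrable (fun y => F (Fin.cons y x)) μ := fun x =>
      integrable_of_abs_le (hsec x) fun y => hB _
    have hHB : ∀ x, |H x| ≤ B := fun x => by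
      have := norm_integral_le_of_norm_le_const (μ := μ) (f := fun y => F (Fin.cons y x))
        (ae_of_all _ fun y => hB _)
      simpa using this
    have hHd : ∀ x i y, H (Function.update x i y) ≤ H x + c := fun x i y => by
      have : H x + c = ∫ z, (F (Fin.cons z x) + c) ∂μ := by
        rw [integral_add (hseci x) (integrable_const _)]
        simp [hH]
      rw [this]
      refine integral_mono (hseci _) ((hseci x).add (integrable_const _)) fun z => ?_
      have := hd (Fin.cons z x) i.succ y
      rwa [← Fin.cons_update] at this
    have hinner : ∀ x, ∫ y, Real.exp (s * F (Fin.cons y x)) ∂μ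
        ≤ Real.exp (s * H x) * Real.exp (c ^ 2 * s ^ 2 / 8) := fun x => by
      rw [← Real.exp_add]
      refine integral_exp_mul_le_of_oscillation (hsec x) hc (fun y z => ?_) s
      have := hd (Fin.cons y x) 0 z
      rwa [Fin.update_cons_zero] at this
    have hexpi : Integrable (fun y : 𝒳 × (Fin n → 𝒳) => Real.exp (s * F (Fin.cons y.1 y.2)))
        (μ.prod ν) := integrable_exp_mul_of_abs_le hFc (fun y => hB _) s
    have hmean : ∫ x, F x ∂(Measure.pi fun _ => μ) = ∫ x, H x ∂ν := by
      rw [hint, integral_prod_symm]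
      exact integrable_of_abs_le hFc fun y => hB _
    calc ∫ x, Real.exp (s * F x) ∂(Measure.pi fun _ => μ)
        = ∫ x, ∫ y, Real.exp (s * F (Fin.cons y x)) ∂μ ∂ν := by
          rw [hint, integral_prod_symm _ hexpi]
      _ ≤ ∫ x, Real.exp (s * H x) * Real.exp (c ^ 2 * s ^ 2 / 8) ∂ν :=
          integral_mono hexpi.integral_prod_right
            ((integrable_exp_mul_of_abs_le hHm hHB s).mul_const _) hinner
      _ ≤ Real.exp (s * ∫ x, H x ∂ν + n * (c ^ 2 * s ^ 2 / 8))
            * Real.exp (c ^ 2 * s ^ 2 / 8) := by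
          rw [integral_mul_const]
          exact mul_le_mul_of_nonneg_right (ih H hHm hHB hHd) (Real.exp_pos _).le
      _ = _ := by
          rw [← Real.exp_add, hmean]
          congr 1
          push_cast
          ring

/-- **McDiarmid's inequality** for i.i.d. coordinates. -/
lemma measureReal_ge_le_of_bounded_differences (μ : Measure 𝒳) [IsProbabilityMeasure μ]
    {c : ℝ} (hc : 0 ≤ c) {B : ℝ} {n : ℕ} (F : (Fin n → 𝒳) → ℝ) (hF : Measurable F)
    (hB : ∀ x, |F x| ≤ B) (hd : ∀ x i y, F (Function.update x i y) ≤ F x + c)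
    {ε : ℝ} (hε : 0 ≤ ε) :
    (Measure.pi fun _ => μ).real {x | (∫ x, F x ∂(Measure.pi fun _ => μ)) + ε ≤ F x} ≤
      Real.exp (-(2 * ε ^ 2 / (n * c ^ 2))) := by
  set ν : Measure (Fin n → 𝒳) := Measure.pi fun _ => μ with hν
  set m := ∫ x, F x ∂ν with hm
  have hexp : ∀ t x, Real.exp (t * (F x - m)) = Real.exp (-(t * m)) * Real.exp (t * F x) :=
    fun t x => by
      rw [← Real.exp_add]
      congr 1
      ring
  -- The variance proxy comes from `n c² s² / 8 = n (c / 2)² · s² / 2`.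
  have hsub : HasSubgaussianMGF (fun x => F x - m) (n * (‖c‖₊ / 2) ^ 2) ν := by
    refine ⟨fun t => ?_, fun t => ?_⟩
    · simp_rw [hexp]
      exact (integrable_exp_mul_of_abs_le hF hB t).const_mul _
    · rw [mgf]
      simp_rw [hexp]
      rw [integral_const_mul]
      refine (mul_le_mul_of_nonneg_left
        (integral_exp_mul_le_of_bounded_differences μ hc t F hF hB hd) (Real.exp_pos _).le).trans ?_
      rw [← Real.exp_add]
      refine Real.exp_le_exp.2 (le_of_eq ?_)
      push_cast
      rw [Real.norm_of_nonneg hc]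
      ring
  have h := hsub.measure_ge_le hε
  have hset : {x | m + ε ≤ F x} = {x | ε ≤ F x - m} := by
    ext x
    simp only [Set.mem_ofPred_eq]
    constructor <;> intro h <;> linarith
  rw [hset]
  refine h.trans (le_of_eq ?_)
  push_cast
  rw [Real.norm_of_nonneg hc]
  congr 1
  rw [neg_div]
  congr 1
  rw [show 2 * ((n : ℝ) * (c / 2) ^ 2) = (n * c ^ 2) / 2 by ring, div_div_eq_mul_div]
  ring

end BoundedDifferences

/-! ### Contraction of Rademacher sums. -/

section Contraction

variable {ι : Type*}

lemma bddAbove_range_of_abs_le {f : ι → ℝ} {B : ℝ} (h : ∀ j, |f j| ≤ B) :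
    BddAbove (Set.range f) :=
  ⟨B, by rintro _ ⟨j, rfl⟩; exact (abs_le.1 (h j)).2⟩

/-- This is contraction for a single sign. For a pair `j`, `k` the gain `f j - f k` is at most `L *
|v j - v k|`, and the sign of `v j - v k` decides which of the two indices is tested in the supremum
with `+` and which in the one with `-`. -/
lemma ciSup_add_ciSup_sub_le_of_lipschitz [Nonempty ι] {a f v : ι → ℝ} {L A B : ℝ}
    (ha : ∀ j, |a j| ≤ A) (hv : ∀ j, |v j| ≤ B) (hL : 0 ≤ L)
    (hf : ∀ j k, |f j - f k| ≤ L * |v j - v k|) :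
    (⨆ j, (a j + f j)) + ⨆ j, (a j - f j) ≤ (⨆ j, (a j + L * v j)) + ⨆ j, (a j - L * v j) := by
  have hLv : ∀ j, |L * v j| ≤ L * B := fun j => by
    rw [abs_mul, abs_of_nonneg hL]
    exact mul_le_mul_of_nonneg_left (hv j) hL
  have hadd : BddAbove (Set.range fun j => a j + L * v j) :=
    bddAbove_range_of_abs_le (B := A + L * B) fun j =>
      (abs_add_le _ _).trans (add_le_add (ha j) (hLv j))
  have hsub : BddAbove (Set.range fun j => a j - L * v j) :=
    bddAbove_range_of_abs_le (B := A + L * B) fun j =>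
      (abs_sub _ _).trans (add_le_add (ha j) (hLv j))
  have key : ∀ j k, (a j + f j) + (a k - f k)
      ≤ (⨆ j, (a j + L * v j)) + ⨆ j, (a j - L * v j) := fun j k => by
    have h1 := (le_abs_self _).trans (hf j k)
    have h2 := le_ciSup hadd j
    have h3 := le_ciSup hadd k
    have h4 := le_ciSup hsub j
    have h5 := le_ciSup hsub k
    rcases abs_cases (v j - v k) with ⟨h, _⟩ | ⟨h, _⟩ <;> rw [h] at h1 <;> nlinarith
  have h1 : (⨆ j, (a j + f j)) ≤
      (⨆ j, (a j + L * v j)) + (⨆ j, (a j - L * v j)) - ⨆ j, (a j - f j) := by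
    refine ciSup_le fun j => ?_
    have : (⨆ k, (a k - f k)) ≤
        (⨆ j, (a j + L * v j)) + (⨆ j, (a j - L * v j)) - (a j + f j) :=
      ciSup_le fun k => by linarith [key j k]
    linarith
  linarith

lemma sum_units_int (f : ℤˣ → ℝ) : ∑ s, f s = f 1 + f (-1) := by
  rw [show (Finset.univ : Finset ℤˣ) = {1, -1} from rfl]
  simp

lemma abs_sum_sign_mul_le {n : ℕ} {B : ℝ} (σ : Fin n → ℤˣ) {v : Fin n → ℝ}
    (hv : ∀ i, |v i| ≤ B) : |∑ i, ((σ i : ℤ) : ℝ) * v i| ≤ n * B := by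
  refine (Finset.abs_sum_le_sum_abs _ _).trans ?_
  refine (Finset.sum_le_sum (g := fun _ => B) fun i _ => ?_).trans (by simp)
  rcases Int.units_eq_one_or (σ i) with h | h <;> simpa [h] using hv i

lemma abs_sign_mul (s : ℤˣ) (x : ℝ) : |((s : ℤ) : ℝ) * x| = |x| := by
  rcases Int.units_eq_one_or s with h | h <;> simp [h]

lemma sum_sign_cons {n : ℕ} (F : (Fin (n + 1) → ℤˣ) → ℝ) :
    ∑ σ, F σ = ∑ s : ℤˣ, ∑ σ : Fin n → ℤˣ, F (Fin.cons s σ) := by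
  rw [← (Fin.consEquiv fun _ : Fin (n + 1) => ℤˣ).sum_comp, Fintype.sum_prod_type]
  rfl

/-- **Talagrand's contraction principle** for Rademacher sums, with an offset. -/
lemma sum_ciSup_sign_comp_le [Nonempty ι] {φ : ℝ → ℝ} {L : ℝ} (hL : 0 ≤ L)
    (hφ : ∀ z z', |φ z - φ z'| ≤ L * |z - z'|) {B K : ℝ} {n : ℕ} (u : ι → ℝ)
    {A : ℝ} (hu : ∀ j, |u j| ≤ A) (v : ι → Fin n → ℝ) (hv : ∀ j i, |v j i| ≤ B)
    (hφv : ∀ j i, |φ (v j i)| ≤ K) :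
    ∑ σ : Fin n → ℤˣ, ⨆ j, (u j + ∑ i, ((σ i : ℤ) : ℝ) * φ (v j i)) ≤
      ∑ σ : Fin n → ℤˣ, ⨆ j, (u j + ∑ i, ((σ i : ℤ) : ℝ) * (L * v j i)) := by
  induction n generalizing u A with
  | zero => simp
  | succ n ih =>
    have hLv : ∀ j i, |L * v j i| ≤ L * B := fun j i => by
      rw [abs_mul, abs_of_nonneg hL]
      exact mul_le_mul_of_nonneg_left (hv j i) hL
    rw [sum_sign_cons, sum_sign_cons]
    simp_rw [Fin.sum_univ_succ, Fin.cons_zero, Fin.cons_succ, ← add_assoc]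
    calc ∑ s : ℤˣ, ∑ σ : Fin n → ℤˣ, ⨆ j, (u j + ((s : ℤ) : ℝ) * φ (v j 0)
            + ∑ i, ((σ i : ℤ) : ℝ) * φ (v j i.succ))
        ≤ ∑ s : ℤˣ, ∑ σ : Fin n → ℤˣ, ⨆ j, (u j + ((s : ℤ) : ℝ) * φ (v j 0)
            + ∑ i, ((σ i : ℤ) : ℝ) * (L * v j i.succ)) :=
          Finset.sum_le_sum fun s _ =>
            -- The head term is absorbed into the offset; this is why the statement carries an
            -- arbitrary bounded `u`.
            ih (fun j => u j + ((s : ℤ) : ℝ) * φ (v j 0)) (A := A + K)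
              (fun j => (abs_add_le _ _).trans
                (add_le_add (hu j) ((abs_sign_mul s _).le.trans (hφv j 0))))
              (fun j i => v j i.succ) (fun j i => hv j _) (fun j i => hφv j _)
      _ ≤ _ := by
          -- With the tail signs fixed, the two values of the head sign are paired, and the one-sign
          -- contraction applies.
          rw [Finset.sum_comm, Finset.sum_comm (s := (Finset.univ : Finset ℤˣ))]
          refine Finset.sum_le_sum fun σ _ => ?_
          rw [sum_units_int, sum_units_int]
          have h := ciSup_add_ciSup_sub_le_of_lipschitz (L := L)
            (a := fun j => u j + ∑ i, ((σ i : ℤ) : ℝ) * (L * v j i.succ))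
            (f := fun j => φ (v j 0)) (v := fun j => v j 0)
            (fun j => (abs_add_le _ _).trans
              (add_le_add (hu j) (abs_sum_sign_mul_le σ fun i => hLv j i.succ)))
            (fun j => hv j 0) hL (fun j k => hφ _ _)
          simp only [Units.val_one, Units.val_neg, Int.cast_one, Int.cast_neg, one_mul, neg_mul,
            add_right_comm _ _ (∑ i, _)]
          simp only [← sub_eq_add_neg]
          exact h

end Contraction

/-! ### Symmetrization and the one-sided tail bound for a countable family. -/

section Symmetrization

variable {𝒳 : Type*} {ι : Type*}

lemma abs_ciSup_le [Nonempty ι] {f : ι → ℝ} {B : ℝ} (h : ∀ j, |f j| ≤ B) : |⨆ j, f j| ≤ B := by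
  obtain ⟨j₀⟩ := id ‹Nonempty ι›
  exact abs_le.2 ⟨(abs_le.1 (h j₀)).1.trans (le_ciSup (bddAbove_range_of_abs_le h) j₀),
    ciSup_le fun j => (abs_le.1 (h j)).2⟩

/-- The supremum over a family `f` of the Rademacher sums with signs `σ` at the points `x`. -/
noncomputable def signSup (f : ι → 𝒳 → ℝ) {n : ℕ} (σ : Fin n → ℤˣ) (x : Fin n → 𝒳) : ℝ :=
  ⨆ j, ∑ i, ((σ i : ℤ) : ℝ) * f j (x i)

/-- The largest amount by which a sum over the points `x` falls below its expectation. -/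
noncomputable def deviationSup [MeasurableSpace 𝒳] (μ : Measure 𝒳) (f : ι → 𝒳 → ℝ) {n : ℕ}
    (x : Fin n → 𝒳) : ℝ :=
  ⨆ j, (n * (∫ y, f j y ∂μ) - ∑ i, f j (x i))

variable {f : ι → 𝒳 → ℝ} {K : ℝ} {n : ℕ}

lemma measurable_signSup [MeasurableSpace 𝒳] [Countable ι] (hf : ∀ j, Measurable (f j))
    (σ : Fin n → ℤˣ) :
    Measurable (signSup f σ) :=
  Measurable.iSup fun j => by
    have := hf j
    fun_prop

lemma abs_signSup_le [Nonempty ι] (hK : ∀ j x, |f j x| ≤ K) (σ : Fin n → ℤˣ) (x : Fin n → 𝒳) :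
    |signSup f σ x| ≤ n * K :=
  abs_ciSup_le fun j => abs_sum_sign_mul_le σ fun i => hK j (x i)

lemma measurable_deviationSup [MeasurableSpace 𝒳] [Countable ι] {μ : Measure 𝒳}
    (hf : ∀ j, Measurable (f j)) :
    Measurable (deviationSup μ f (n := n)) :=
  Measurable.iSup fun j => by
    have := hf j
    fun_prop

lemma abs_sum_comp_le (hK : ∀ j x, |f j x| ≤ K) (j : ι) (x : Fin n → 𝒳) :
    |∑ i, f j (x i)| ≤ n * K :=
  (Finset.abs_sum_le_sum_abs _ _).trans
    ((Finset.sum_le_sum fun i _ => hK j (x i)).trans (by simp))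

lemma abs_deviation_le [MeasurableSpace 𝒳] {μ : Measure 𝒳} [IsProbabilityMeasure μ]
    (hK : ∀ j x, |f j x| ≤ K)
    (j : ι) (x : Fin n → 𝒳) : |n * (∫ y, f j y ∂μ) - ∑ i, f j (x i)| ≤ n * K + n * K := by
  refine (abs_sub _ _).trans (add_le_add ?_ (abs_sum_comp_le hK j x))
  rw [abs_mul, Nat.abs_cast]
  refine mul_le_mul_of_nonneg_left ?_ (Nat.cast_nonneg n)
  have := norm_integral_le_of_norm_le_const (μ := μ) (f := f j) (ae_of_all _ (hK j))
  simpa using this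

lemma abs_deviationSup_le [MeasurableSpace 𝒳] [Nonempty ι] {μ : Measure 𝒳} [IsProbabilityMeasure μ]
    (hK : ∀ j x, |f j x| ≤ K)
    (x : Fin n → 𝒳) : |deviationSup μ f x| ≤ n * K + n * K :=
  abs_ciSup_le fun j => abs_deviation_le hK j x

/-- Exchange of the two entries of the pairs whose sign is negative. -/
def signSwap (σ : Fin n → ℤˣ) (z : Fin n → 𝒳 × 𝒳) : Fin n → 𝒳 × 𝒳 :=
  fun i => if σ i = 1 then z i else (z i).swap

/-- The two entries of a pair are independent with the same law, so exchanging them preserves the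
law. This is how random signs enter the symmetrization. -/
lemma measurePreserving_signSwap [MeasurableSpace 𝒳] (μ : Measure 𝒳) [IsProbabilityMeasure μ]
    (σ : Fin n → ℤˣ) :
    MeasurePreserving (signSwap σ) (Measure.pi fun _ : Fin n => μ.prod μ)
      (Measure.pi fun _ => μ.prod μ) := by
  refine measurePreserving_pi (fun _ => μ.prod μ) (fun _ => μ.prod μ)
    (f := fun i z => if σ i = 1 then z else z.swap) fun i => ?_
  by_cases h : σ i = 1
  · simp only [h, if_true]
    exact MeasurePreserving.id (μ.prod μ)
  · simpa [h] using Measure.measurePreserving_swap (μ := μ) (ν := μ)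

/-- **Symmetrization**. -/
lemma integral_deviationSup_le [MeasurableSpace 𝒳] [Countable ι] [Nonempty ι] (μ : Measure 𝒳)
    [IsProbabilityMeasure μ]
    (hf : ∀ j, Measurable (f j)) (hK : ∀ j x, |f j x| ≤ K) :
    2 ^ n * ∫ x : Fin n → 𝒳, deviationSup μ f x ∂(Measure.pi fun _ => μ) ≤
      2 * ∑ σ : Fin n → ℤˣ, ∫ x, signSup f σ x ∂(Measure.pi fun _ => μ) := by
  set ν : Measure (Fin n → 𝒳) := Measure.pi fun _ => μ with hν
  set ρ : Measure (Fin n → 𝒳 × 𝒳) := Measure.pi fun _ => μ.prod μ with hρ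
  set D : (Fin n → 𝒳 × 𝒳) → ℝ := fun z => ⨆ j, ∑ i, (f j (z i).1 - f j (z i).2) with hD
  have hDm : Measurable D := Measurable.iSup fun j => by
    have := hf j
    fun_prop
  have hterm : ∀ j (z : Fin n → 𝒳 × 𝒳), |∑ i, (f j (z i).1 - f j (z i).2)| ≤ n * K + n * K :=
    fun j z => by
      rw [Finset.sum_sub_distrib]
      exact (abs_sub _ _).trans (add_le_add (abs_sum_comp_le hK j fun i => (z i).1)
        (abs_sum_comp_le hK j fun i => (z i).2))
  have hDB : ∀ z, |D z| ≤ n * K + n * K := fun z => abs_ciSup_le fun j => hterm j z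
  have hmp := (measurePreserving_arrowProdEquivProdArrow 𝒳 𝒳 (Fin n) (fun _ => μ)
    (fun _ => μ)).symm
  have hpair : Measurable fun y : (Fin n → 𝒳) × (Fin n → 𝒳) => fun i => (y.1 i, y.2 i) := by
    fun_prop
  have hmpi : ∀ h : (Fin n → 𝒳 × 𝒳) → ℝ,
      ∫ y, h (fun i => (y.1 i, y.2 i)) ∂(ν.prod ν) = ∫ z, h z ∂ρ := fun h =>
    hmp.integral_comp' h
  have hprodi : Integrable (fun y : (Fin n → 𝒳) × (Fin n → 𝒳) => D fun i => (y.1 i, y.2 i))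
      (ν.prod ν) := integrable_of_abs_le (hDm.comp hpair) fun y => hDB _
  have hfi : ∀ j (i : Fin n), Integrable (fun x : Fin n → 𝒳 => f j (x i)) ν := fun j i =>
    integrable_of_abs_le ((hf j).comp (measurable_pi_apply i)) fun x => hK _ _
  have hmean : ∀ j, ∫ x : Fin n → 𝒳, ∑ i, f j (x i) ∂ν = n * ∫ y, f j y ∂μ := fun j => by
    rw [integral_finsetSum _ fun i _ => hfi j i]
    simp_rw [hν, integral_comp_eval (μ := fun _ : Fin n => μ) (hf j).aestronglyMeasurable]
    simp
  -- The expectation is written as the mean over a ghost sample `x'`, and a supremum of integrals is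
  -- at most the integral of the supremum.
  have hjensen : ∀ x : Fin n → 𝒳, deviationSup μ f x ≤ ∫ x', D (fun i => (x' i, x i)) ∂ν := by
    refine fun x => ciSup_le fun j => ?_
    have h1 : n * (∫ y, f j y ∂μ) - ∑ i, f j (x i)
        = ∫ x' : Fin n → 𝒳, ∑ i, (f j (x' i) - f j (x i)) ∂ν := by
      simp_rw [Finset.sum_sub_distrib]
      rw [integral_sub (integrable_finsetSum _ fun i _ => hfi j i) (integrable_const _), hmean]
      simp
    rw [h1]
    refine integral_mono ?_ ?_ fun x' => ?_
    · exact integrable_finsetSum _ fun i _ => (hfi j i).sub (integrable_const _)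
    · exact integrable_of_abs_le (hDm.comp (by fun_prop)) fun y => hDB _
    · exact le_ciSup (f := fun j => ∑ i, (f j (x' i) - f j (x i)))
        (bddAbove_range_of_abs_le fun j => hterm j fun i => (x' i, x i)) j
  have hghost : ∫ x, deviationSup μ f x ∂ν ≤ ∫ z, D z ∂ρ := by
    rw [← hmpi, integral_prod_symm _ hprodi]
    exact integral_mono (integrable_of_abs_le (measurable_deviationSup hf)
      fun x => abs_deviationSup_le hK x) hprodi.integral_prod_right hjensen
  have hsi : ∀ σ : Fin n → ℤˣ, Integrable (signSup f σ) ν := fun σ =>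
    integrable_of_abs_le (measurable_signSup hf σ) (abs_signSup_le hK σ)
  have hfst : MeasurePreserving (fun (z : Fin n → 𝒳 × 𝒳) i => (z i).1) ρ ν :=
    measurePreserving_pi _ _ fun _ => measurePreserving_fst
  have hsnd : MeasurePreserving (fun (z : Fin n → 𝒳 × 𝒳) i => (z i).2) ρ ν :=
    measurePreserving_pi _ _ fun _ => measurePreserving_snd
  -- Exchanging the entries of a pair multiplies its difference by the sign; the supremum is then
  -- split over the two samples. The sum over all `σ` does not distinguish `σ` from `-σ`, whence the
  -- factor 2.
  have hsplit : ∀ σ (z : Fin n → 𝒳 × 𝒳), D (signSwap σ z)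
      ≤ signSup f σ (fun i => (z i).1) + signSup f (-σ) (fun i => (z i).2) := by
    refine fun σ z => ciSup_le fun j => ?_
    have h1 : ∑ i, (f j (signSwap σ z i).1 - f j (signSwap σ z i).2)
        = ∑ i, ((σ i : ℤ) : ℝ) * f j (z i).1 + ∑ i, (((-σ) i : ℤ) : ℝ) * f j (z i).2 := by
      rw [← Finset.sum_add_distrib]
      refine Finset.sum_congr rfl fun i _ => ?_
      rcases Int.units_eq_one_or (σ i) with h | h <;> simp [signSwap, h] <;> ring
    rw [h1]
    exact add_le_add
      (le_ciSup (f := fun j => ∑ i, ((σ i : ℤ) : ℝ) * f j (z i).1)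
        (bddAbove_range_of_abs_le fun j => abs_sum_sign_mul_le σ fun i => hK j _) j)
      (le_ciSup (f := fun j => ∑ i, (((-σ) i : ℤ) : ℝ) * f j (z i).2)
        (bddAbove_range_of_abs_le fun j => abs_sum_sign_mul_le (-σ) fun i => hK j _) j)
  have hσ : ∀ σ : Fin n → ℤˣ,
      ∫ z, D z ∂ρ ≤ ∫ x, signSup f σ x ∂ν + ∫ x, signSup f (-σ) x ∂ν := fun σ => by
    have hsw := measurePreserving_signSwap (n := n) μ σ
    have hcomp : ∀ {T : (Fin n → 𝒳 × 𝒳) → Fin n → 𝒳} (_ : MeasurePreserving T ρ ν)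
        (τ : Fin n → ℤˣ), Integrable (fun z => signSup f τ (T z)) ρ ∧
          ∫ z, signSup f τ (T z) ∂ρ = ∫ x, signSup f τ x ∂ν := fun {T} hT τ => by
      refine ⟨hT.integrable_comp_of_integrable (hsi τ), ?_⟩
      rw [← hT.map_eq, integral_map hT.measurable.aemeasurable
        (measurable_signSup hf τ).aestronglyMeasurable]
    calc ∫ z, D z ∂ρ = ∫ z, D (signSwap σ z) ∂ρ := by
          conv_lhs => rw [hρ, ← hsw.map_eq]
          rw [integral_map hsw.measurable.aemeasurable hDm.aestronglyMeasurable]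
      _ ≤ ∫ z, (signSup f σ (fun i => (z i).1) + signSup f (-σ) (fun i => (z i).2)) ∂ρ :=
          integral_mono (integrable_of_abs_le (hDm.comp hsw.measurable) fun z => hDB _)
            ((hcomp hfst σ).1.add (hcomp hsnd (-σ)).1) (hsplit σ)
      _ = _ := by
          rw [integral_add (hcomp hfst σ).1 (hcomp hsnd (-σ)).1, (hcomp hfst σ).2,
            (hcomp hsnd (-σ)).2]
  have hneg : ∑ σ : Fin n → ℤˣ, ∫ x, signSup f (-σ) x ∂ν = ∑ σ, ∫ x, signSup f σ x ∂ν :=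
    Equiv.sum_comp (Equiv.neg (Fin n → ℤˣ)) fun σ => ∫ x, signSup f σ x ∂ν
  have hsum := Finset.sum_le_sum fun σ (_ : σ ∈ (Finset.univ : Finset (Fin n → ℤˣ))) => hσ σ
  rw [Finset.sum_add_distrib, Finset.sum_const, Finset.card_univ, nsmul_eq_mul,
    Fintype.card_pi_const, Fintype.card_units_int, hneg] at hsum
  push_cast at hsum
  have := mul_le_mul_of_nonneg_left hghost (by positivity : (0 : ℝ) ≤ 2 ^ n)
  linarith

/-- Symmetrization followed by contraction. -/
lemma integral_deviationSup_comp_le [MeasurableSpace 𝒳] [Countable ι] [Nonempty ι] (μ : Measure 𝒳)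
    [IsProbabilityMeasure μ]
    {G : ι → 𝒳 → ℝ} (hG : ∀ j, Measurable (G j)) {B : ℝ} (hB : ∀ j x, |G j x| ≤ B)
    {φ : ℝ → ℝ} {L : ℝ} (hL : 0 ≤ L) (hφ : ∀ z z', |φ z - φ z'| ≤ L * |z - z'|)
    (hφm : Measurable φ) (hK : ∀ z, |z| ≤ B → |φ z| ≤ K) :
    2 ^ n * ∫ x : Fin n → 𝒳, deviationSup μ (fun j y => φ (G j y)) x ∂(Measure.pi fun _ => μ) ≤
      2 * L * ∫ x, ∑ σ : Fin n → ℤˣ, signSup G σ x ∂(Measure.pi fun _ => μ) := by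
  have hφG : ∀ j x, |φ (G j x)| ≤ K := fun j x => hK _ (hB j x)
  have hφGm : ∀ j, Measurable fun y => φ (G j y) := fun j => hφm.comp (hG j)
  refine (integral_deviationSup_le μ hφGm hφG).trans ?_
  rw [mul_assoc]
  refine mul_le_mul_of_nonneg_left ?_ zero_le_two
  have hi1 : ∀ σ : Fin n → ℤˣ, Integrable (signSup (fun j y => φ (G j y)) σ)
      (Measure.pi fun _ => μ) := fun σ =>
    integrable_of_abs_le (measurable_signSup hφGm σ) (abs_signSup_le hφG σ)
  have hi2 : ∀ σ : Fin n → ℤˣ, Integrable (signSup G σ) (Measure.pi fun _ => μ) := fun σ =>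
    integrable_of_abs_le (measurable_signSup hG σ) (abs_signSup_le hB σ)
  rw [← integral_finsetSum _ fun σ _ => hi1 σ, ← integral_const_mul]
  refine integral_mono (integrable_finsetSum _ fun σ _ => hi1 σ)
    ((integrable_finsetSum _ fun σ _ => hi2 σ).const_mul L) fun x => ?_
  have h := sum_ciSup_sign_comp_le hL hφ (u := fun _ : ι => 0) (A := 0) (by simp)
    (fun j i => G j (x i)) (fun j i => hB j (x i)) (fun j i => hφG j (x i))
  simp only [zero_add] at h
  refine h.trans (le_of_eq ?_)
  rw [Finset.mul_sum]
  refine Finset.sum_congr rfl fun σ _ => ?_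
  rw [signSup, Real.mul_iSup_of_nonneg hL]
  congr 1
  ext j
  rw [Finset.mul_sum]
  exact Finset.sum_congr rfl fun i _ => by ring

/-- Moving one sample point changes a single summand of each member by at most `c`. This is the
bounded-difference hypothesis of McDiarmid's inequality. -/
lemma deviationSup_update_le [MeasurableSpace 𝒳] [Nonempty ι] (μ : Measure 𝒳)
    [IsProbabilityMeasure μ]
    (hK : ∀ j x, |f j x| ≤ K) {c : ℝ} (hc : ∀ j x y, f j x ≤ f j y + c)
    (x : Fin n → 𝒳) (i : Fin n) (y : 𝒳) :
    deviationSup μ f (Function.update x i y) ≤ deviationSup μ f x + c := by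
  refine ciSup_le fun j => ?_
  have h := le_ciSup (f := fun j => n * (∫ y, f j y ∂μ) - ∑ i, f j (x i))
    (bddAbove_range_of_abs_le fun j => abs_deviation_le hK j x) j
  have h1 : ∑ k, f j (Function.update x i y k) = ∑ k, f j (x k) + (f j y - f j (x i)) := by
    rw [← Finset.add_sum_erase _ _ (Finset.mem_univ i),
      ← Finset.add_sum_erase _ (fun k => f j (x k)) (Finset.mem_univ i),
      Finset.sum_congr rfl fun k hk => by rw [Function.update_of_ne (Finset.ne_of_mem_erase hk)]]
    simp
    ring
  rw [h1]
  have := hc j (x i) y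
  unfold deviationSup
  linarith

/-- One-sided uniform deviation bound for the composition of a family with a Lipschitz function,
in terms of an upper bound `r` on the Rademacher average of the family. -/
lemma measureReal_deviationSup_ge_le [MeasurableSpace 𝒳] [Countable ι] [Nonempty ι] (μ : Measure 𝒳)
    [IsProbabilityMeasure μ]
    {G : ι → 𝒳 → ℝ} (hG : ∀ j, Measurable (G j)) {B : ℝ} (hB : ∀ j x, |G j x| ≤ B)
    {φ : ℝ → ℝ} {L : ℝ} (hL : 0 ≤ L) (hφ : ∀ z z', |φ z - φ z'| ≤ L * |z - z'|)
    (hφm : Measurable φ) {m c : ℝ} (hm : ∀ z, |z| ≤ B → m ≤ φ z ∧ φ z ≤ m + c) (hc : 0 ≤ c)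
    {r : ℝ} (hr : ∫ x : Fin n → 𝒳, (1 / 2 ^ n : ℝ) * ∑ σ : Fin n → ℤˣ, signSup G σ x
      ∂(Measure.pi fun _ => μ) ≤ r) {ε : ℝ} (hε : 0 ≤ ε) :
    (Measure.pi fun _ : Fin n => μ).real
        {x | 2 * L * r + ε ≤ deviationSup μ (fun j y => φ (G j y)) x} ≤
      Real.exp (-(2 * ε ^ 2 / (n * c ^ 2))) := by
  -- This crude bound serves integrability only; the tail depends on the oscillation `c` alone.
  have hK : ∀ z, |z| ≤ B → |φ z| ≤ |m| + c := fun z hz => by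
    have := hm z hz
    have h1 := neg_abs_le m
    have h2 := le_abs_self m
    exact abs_le.2 ⟨by linarith, by linarith⟩
  have hφG : ∀ j x, |φ (G j x)| ≤ |m| + c := fun j x => hK _ (hB j x)
  have hφGm : ∀ j, Measurable fun y => φ (G j y) := fun j => hφm.comp (hG j)
  have hmean : ∫ x : Fin n → 𝒳, deviationSup μ (fun j y => φ (G j y)) x
      ∂(Measure.pi fun _ => μ) ≤ 2 * L * r := by
    have h := integral_deviationSup_comp_le (n := n) μ hG hB hL hφ hφm hK
    rw [integral_const_mul, one_div, inv_mul_le_iff₀ (by positivity)] at hr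
    have h2 := mul_le_mul_of_nonneg_left hr (by positivity : 0 ≤ 2 * L)
    refine le_of_mul_le_mul_left (a := (2 : ℝ) ^ n) ?_ (by positivity)
    linarith
  refine le_trans (measureReal_mono fun x hx => ?_)
    (measureReal_ge_le_of_bounded_differences μ hc
      (deviationSup μ (fun j y => φ (G j y)) (n := n)) (measurable_deviationSup hφGm)
      (abs_deviationSup_le hφG) (deviationSup_update_le μ hφG fun j x y => ?_) hε)
  · simp only [Set.mem_ofPred_eq] at hx ⊢
    linarith
  · have h1 := hm _ (hB j x)
    have h2 := hm _ (hB j y)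
    linarith

end Symmetrization

/-! ### Uniform deviation over a pointwise separable class. -/

section UniformDeviation

variable {𝒳 : Type*}

lemma PointwiseSeparable.exists_seq {𝒢 : Set (𝒳 → ℝ)} (h : PointwiseSeparable 𝒢)
    (hne : 𝒢.Nonempty) :
    ∃ G : ℕ → 𝒳 → ℝ, (∀ j, G j ∈ 𝒢) ∧
      ∀ g ∈ 𝒢, ∃ v : ℕ → ℕ, ∀ x, Tendsto (fun k => G (v k) x) atTop (𝓝 (g x)) := by
  obtain ⟨𝒢₀, hsub, hcount, hdense⟩ := h
  have hne₀ : 𝒢₀.Nonempty := by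
    obtain ⟨g, hg⟩ := hne
    obtain ⟨u, hu, -⟩ := hdense g hg
    exact ⟨u 0, hu 0⟩
  obtain ⟨G, rfl⟩ := hcount.exists_eq_range hne₀
  refine ⟨G, fun j => hsub ⟨j, rfl⟩, fun g hg => ?_⟩
  obtain ⟨u, hu, hlim⟩ := hdense g hg
  choose v hv using hu
  exact ⟨v, fun x => by simpa only [hv] using hlim x⟩

/-- A sign sum involves finitely many evaluations, so it passes to pointwise limits and the dense
sequence attains the same supremum. -/
lemma iSup_sign_sum_eq_signSup {𝒢 : Set (𝒳 → ℝ)} {B : ℝ} (hB : ∀ g ∈ 𝒢, ∀ x, |g x| ≤ B)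
    {G : ℕ → 𝒳 → ℝ} (hG : ∀ j, G j ∈ 𝒢)
    (hlim : ∀ g ∈ 𝒢, ∃ v : ℕ → ℕ, ∀ x, Tendsto (fun k => G (v k) x) atTop (𝓝 (g x)))
    {n : ℕ} (σ : Fin n → ℤˣ) (x : Fin n → 𝒳) :
    ⨆ g : 𝒢, (1 / n : ℝ) * ∑ i, ((σ i : ℤ) : ℝ) * (g : 𝒳 → ℝ) (x i)
      = (1 / n : ℝ) * signSup G σ x := by
  rw [← Real.mul_iSup_of_nonneg (by positivity)]
  congr 1
  have : Nonempty 𝒢 := ⟨⟨G 0, hG 0⟩⟩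
  have hb1 : BddAbove (Set.range fun g : 𝒢 => ∑ i, ((σ i : ℤ) : ℝ) * (g : 𝒳 → ℝ) (x i)) :=
    bddAbove_range_of_abs_le fun g => abs_sum_sign_mul_le σ fun i => hB g g.2 (x i)
  have hb2 : BddAbove (Set.range fun j => ∑ i, ((σ i : ℤ) : ℝ) * G j (x i)) :=
    bddAbove_range_of_abs_le fun j => abs_sum_sign_mul_le σ fun i => hB _ (hG j) (x i)
  refine le_antisymm (ciSup_le fun g => ?_)
    (ciSup_le fun j => le_ciSup_of_le hb1 ⟨G j, hG j⟩ le_rfl)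
  obtain ⟨v, hv⟩ := hlim g g.2
  refine le_of_tendsto (tendsto_finsetSum _ fun i _ => (hv (x i)).const_mul ((σ i : ℤ) : ℝ))
    (Eventually.of_forall fun k => le_ciSup hb2 (v k))

variable [MeasurableSpace 𝒳]

lemma rademacherComplexity_eq {𝒢 : Set (𝒳 → ℝ)} {B : ℝ} (hB : ∀ g ∈ 𝒢, ∀ x, |g x| ≤ B)
    {G : ℕ → 𝒳 → ℝ} (hG : ∀ j, G j ∈ 𝒢)
    (hlim : ∀ g ∈ 𝒢, ∃ v : ℕ → ℕ, ∀ x, Tendsto (fun k => G (v k) x) atTop (𝓝 (g x)))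
    (n : ℕ) (μ : Measure 𝒳) :
    rademacherComplexity 𝒢 n μ = (1 / n : ℝ) *
      ∫ x : Fin n → 𝒳, (1 / 2 ^ n : ℝ) * ∑ σ : Fin n → ℤˣ, signSup G σ x
        ∂(Measure.pi fun _ => μ) := by
  rw [rademacherComplexity, ← integral_const_mul]
  simp_rw [iSup_sign_sum_eq_signSup hB hG hlim, ← Finset.mul_sum]
  congr 1
  ext x
  ring

/-- For a fixed member of `𝒢` the sums for `σ` and `-σ` cancel, so the suprema for `σ` and `-σ` have
nonnegative total. This forces the constant `CG` to be nonnegative. -/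
lemma rademacherComplexity_nonneg {𝒢 : Set (𝒳 → ℝ)} (hne : 𝒢.Nonempty) {B : ℝ}
    (hB : ∀ g ∈ 𝒢, ∀ x, |g x| ≤ B) (n : ℕ) (μ : Measure 𝒳) :
    0 ≤ rademacherComplexity 𝒢 n μ := by
  obtain ⟨g, hg⟩ := hne
  refine integral_nonneg fun x => mul_nonneg (by positivity) ?_
  set S : (Fin n → ℤˣ) → ℝ := fun σ =>
    ⨆ g : 𝒢, (1 / n : ℝ) * ∑ i, ((σ i : ℤ) : ℝ) * (g : 𝒳 → ℝ) (x i) with hS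
  have hle : ∀ σ, (1 / n : ℝ) * ∑ i, ((σ i : ℤ) : ℝ) * g (x i) ≤ S σ := fun σ => by
    refine le_ciSup (f := fun g : 𝒢 => (1 / n : ℝ) * ∑ i, ((σ i : ℤ) : ℝ) * (g : 𝒳 → ℝ) (x i))
      (bddAbove_range_of_abs_le (B := (1 / n : ℝ) * (n * B)) fun g => ?_) ⟨g, hg⟩
    rw [abs_mul, abs_of_nonneg (by positivity : (0 : ℝ) ≤ 1 / n)]
    exact mul_le_mul_of_nonneg_left (abs_sum_sign_mul_le σ fun i => hB g g.2 (x i))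
      (by positivity)
  have hneg : ∑ σ, S (-σ) = ∑ σ, S σ := Equiv.sum_comp (Equiv.neg (Fin n → ℤˣ)) S
  have hsum : 0 ≤ ∑ σ, (S σ + S (-σ)) := Finset.sum_nonneg fun σ _ => by
    have h1 := hle σ
    have h2 := hle (-σ)
    simp only [Pi.neg_apply, Units.val_neg, Int.cast_neg, neg_mul, Finset.sum_neg_distrib,
      mul_neg] at h2
    linarith
  rw [Finset.sum_add_distrib, hneg] at hsum
  change 0 ≤ ∑ σ, S σ
  linarith

/-- A pointwise limit of members of a family deviates at most as much as the family. -/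
lemma deviation_le_of_tendsto {μ : Measure 𝒳} [IsProbabilityMeasure μ] {f : ℕ → 𝒳 → ℝ}
    (hf : ∀ j, Measurable (f j)) {K : ℝ} (hK : ∀ j x, |f j x| ≤ K) {g : 𝒳 → ℝ} {v : ℕ → ℕ}
    (hv : ∀ x, Tendsto (fun k => f (v k) x) atTop (𝓝 (g x))) {n : ℕ} (x : Fin n → 𝒳) :
    n * (∫ y, g y ∂μ) - ∑ i, g (x i) ≤ deviationSup μ f x := by
  have hint : Tendsto (fun k => ∫ y, f (v k) y ∂μ) atTop (𝓝 (∫ y, g y ∂μ)) :=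
    tendsto_integral_of_dominated_convergence (fun _ => K)
      (fun k => (hf _).aestronglyMeasurable) (integrable_const _)
      (fun k => ae_of_all _ (hK _)) (ae_of_all _ hv)
  refine le_of_tendsto ((hint.const_mul (n : ℝ)).sub
    (tendsto_finsetSum _ fun i _ => hv (x i))) (Eventually.of_forall fun k => ?_)
  exact le_ciSup (f := fun j => n * (∫ y, f j y ∂μ) - ∑ i, f j (x i))
    (bddAbove_range_of_abs_le fun j => abs_deviation_le hK j x) (v k)

/-- Tail bound for the uniform one-sided deviation over a class composed with a Lipschitz
function. -/
lemma exists_event_one_sided_deviation {Ω : Type*} [MeasurableSpace Ω] {P : Measure Ω}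
    [IsProbabilityMeasure P] {μ : Measure 𝒳} {n : ℕ} (hn : 0 < n) {X : Fin n → Ω → 𝒳}
    (hX : ∀ i, Measurable (X i)) (hind : iIndepFun X P) (hlaw : ∀ i, P.map (X i) = μ)
    {𝒢 : Set (𝒳 → ℝ)} (h𝒢 : ∀ g ∈ 𝒢, Measurable g) (hsep : PointwiseSeparable 𝒢)
    (hne : 𝒢.Nonempty) {B : ℝ} (hB : ∀ g ∈ 𝒢, ∀ x, |g x| ≤ B)
    {r : ℝ} (hr : rademacherComplexity 𝒢 n μ ≤ r)
    {φ : ℝ → ℝ} {L : ℝ} (hL : 0 ≤ L) (hφ : ∀ z z', |φ z - φ z'| ≤ L * |z - z'|)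
    {m c : ℝ} (hm : ∀ z, |z| ≤ B → m ≤ φ z ∧ φ z ≤ m + c) (hc : 0 ≤ c)
    {ε : ℝ} (hε : 0 ≤ ε) :
    ∃ N : Set Ω, MeasurableSet N ∧ P.real N ≤ Real.exp (-(2 * n * ε ^ 2 / c ^ 2)) ∧
      ∀ ω, ω ∉ N → ∀ g ∈ 𝒢,
        (∫ y, φ (g y) ∂μ) - (1 / n : ℝ) * ∑ i, φ (g (X i ω)) ≤ 2 * L * r + ε := by
  have hn' : (0 : ℝ) < n := Nat.cast_pos.2 hn
  have : IsProbabilityMeasure μ := by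
    rw [← hlaw ⟨0, hn⟩]
    exact Measure.isProbabilityMeasure_map (hX _).aemeasurable
  obtain ⟨G, hG, hlim⟩ := hsep.exists_seq hne
  have hGm : ∀ j, Measurable (G j) := fun j => h𝒢 _ (hG j)
  have hGB : ∀ j x, |G j x| ≤ B := fun j => hB _ (hG j)
  have hφc : Continuous φ :=
    (LipschitzWith.of_dist_le_mul (K := ⟨L, hL⟩) fun z z' => by
      rw [Real.dist_eq, Real.dist_eq]
      exact hφ z z').continuous
  have hφGm : ∀ j, Measurable fun y => φ (G j y) := fun j => hφc.measurable.comp (hGm j)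
  have hφG : ∀ j x, |φ (G j x)| ≤ |m| + c := fun j x => by
    have := hm _ (hGB j x)
    have h1 := neg_abs_le m
    have h2 := le_abs_self m
    exact abs_le.2 ⟨by linarith, by linarith⟩
  rw [rademacherComplexity_eq hB hG hlim, one_div, inv_mul_le_iff₀ hn'] at hr
  have hXm : Measurable fun ω i => X i ω := measurable_pi_iff.2 hX
  have hmap : P.map (fun ω i => X i ω) = Measure.pi fun _ => μ := by
    rw [hind.map_fun_eq_pi_map fun i => (hX i).aemeasurable]
    simp_rw [hlaw]
  set T : Set (Fin n → 𝒳) :=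
    {x | 2 * L * (n * r) + n * ε ≤ deviationSup μ (fun j y => φ (G j y)) x} with hT
  have hTm : MeasurableSet T := measurableSet_le measurable_const (measurable_deviationSup hφGm)
  refine ⟨(fun ω i => X i ω) ⁻¹' T, hXm hTm, ?_, fun ω hω g hg => ?_⟩
  · rw [← map_measureReal_apply hXm hTm, hmap]
    refine (measureReal_deviationSup_ge_le μ hGm hGB hL hφ hφc.measurable hm hc hr
      (by positivity : 0 ≤ n * ε)).trans (le_of_eq ?_)
    -- Deviations are not normalized, so the threshold is `n * ε` and one factor `n` of its square
    -- cancels.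
    congr 2
    rw [show 2 * (n * ε) ^ 2 = n * (2 * n * ε ^ 2) by ring,
      mul_div_mul_left _ _ hn'.ne']
  · obtain ⟨v, hv⟩ := hlim g hg
    have h1 := deviation_le_of_tendsto (μ := μ) (g := fun y => φ (g y)) hφGm hφG
      (fun x => (hφc.tendsto _).comp (hv x)) fun i => X i ω
    have h2 : deviationSup μ (fun j y => φ (G j y)) (fun i => X i ω)
        < 2 * L * (n * r) + n * ε := not_le.1 hω
    have h3 : n * ((∫ y, φ (g y) ∂μ) - (1 / n : ℝ) * ∑ i, φ (g (X i ω)))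
        ≤ n * (2 * L * r + ε) := by
      rw [mul_sub, ← mul_assoc, mul_one_div_cancel hn'.ne', one_mul]
      linarith
    exact le_of_mul_le_mul_left h3 hn'

/-- Two-sided uniform deviation bound at confidence level `2 (δ / 4) ^ 4`. -/
lemma exists_event_uniform_deviation {Ω : Type*} [MeasurableSpace Ω] {P : Measure Ω}
    [IsProbabilityMeasure P] {μ : Measure 𝒳} {n : ℕ} (hn : 0 < n) {X : Fin n → Ω → 𝒳}
    (hX : ∀ i, Measurable (X i)) (hind : iIndepFun X P) (hlaw : ∀ i, P.map (X i) = μ)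
    {𝒢 : Set (𝒳 → ℝ)} (h𝒢 : ∀ g ∈ 𝒢, Measurable g) (hsep : PointwiseSeparable 𝒢)
    (hne : 𝒢.Nonempty) {B : ℝ} (hB : ∀ g ∈ 𝒢, ∀ x, |g x| ≤ B)
    {CG : ℝ} (hr : rademacherComplexity 𝒢 n μ ≤ CG / √n)
    {φ : ℝ → ℝ} {L : ℝ} (hL : 0 ≤ L) (hφ : ∀ z z', |φ z - φ z'| ≤ L * |z - z'|)
    {m c : ℝ} (hm : ∀ z, |z| ≤ B → m ≤ φ z ∧ φ z ≤ m + c) (hc : 0 ≤ c)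
    {δ : ℝ} (hδ : 0 < δ) (hδ4 : δ ≤ 4) :
    ∃ N : Set Ω, MeasurableSet N ∧ P.real N ≤ 2 * (δ / 4) ^ 4 ∧
      ∀ ω, ω ∉ N → ∀ g ∈ 𝒢,
        |(∫ y, φ (g y) ∂μ) - (1 / n : ℝ) * ∑ i, φ (g (X i ω))| ≤
          (4 * L * CG + 2 * c * √(Real.log (4 / δ))) / √(2 * n) := by
  have hn' : (0 : ℝ) < n := Nat.cast_pos.2 hn
  have hsn : 0 < √(n : ℝ) := Real.sqrt_pos.2 hn'
  have hlog : 0 ≤ Real.log (4 / δ) := Real.log_nonneg ((one_le_div hδ).2 hδ4)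
  have hCG : 0 ≤ CG := by
    have := (rademacherComplexity_nonneg hne hB n μ).trans hr
    rwa [le_div_iff₀ hsn, zero_mul] at this
  -- For zero oscillation the exponent would divide by `c ^ 2 = 0`; here `φ` is constant on the
  -- range of the class and the deviation vanishes.
  rcases hc.eq_or_lt with rfl | hc
  · have hφm : ∀ g ∈ 𝒢, ∀ x, φ (g x) = m := fun g hg x => by
      have := hm _ (hB g hg x)
      linarith
    have : IsProbabilityMeasure μ := by
      rw [← hlaw ⟨0, hn⟩]
      exact Measure.isProbabilityMeasure_map (hX _).aemeasurable
    refine ⟨∅, MeasurableSet.empty, by rw [measureReal_empty]; positivity, fun ω _ g hg => ?_⟩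
    simp only [hφm g hg, integral_const, probReal_univ, Finset.sum_const, Finset.card_univ,
      Fintype.card_fin, nsmul_eq_mul, smul_eq_mul]
    rw [← mul_assoc, one_div_mul_cancel hn'.ne', sub_self, abs_zero]
    positivity
  -- This is exactly `2 * c * √(log (4 / δ)) / √(2 * n)`, and it makes the tail `exp (-4 log (4 /
  -- δ))`.
  set ε : ℝ := c * √2 * √(Real.log (4 / δ)) / √n with hε
  have hε0 : 0 ≤ ε := by positivity
  have htail : Real.exp (-(2 * n * ε ^ 2 / c ^ 2)) = (δ / 4) ^ 4 := by
    have h1 : 2 * n * ε ^ 2 / c ^ 2 = 4 * Real.log (4 / δ) := by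
      rw [hε, div_pow, mul_pow, mul_pow, Real.sq_sqrt hlog, Real.sq_sqrt zero_le_two,
        Real.sq_sqrt hn'.le]
      field_simp
      ring
    rw [h1, ← mul_neg, ← Real.log_inv, inv_div, mul_comm, Real.exp_mul,
      Real.exp_log (by positivity)]
    norm_cast
  have hthr : 2 * L * (CG / √n) + ε ≤
      (4 * L * CG + 2 * c * √(Real.log (4 / δ))) / √(2 * n) := by
    have h2 : 0 < √(2 : ℝ) := Real.sqrt_pos.2 zero_lt_two
    have hs : √(2 : ℝ) * √2 = 2 := Real.mul_self_sqrt zero_le_two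
    -- The Rademacher term has room to spare: `2 * √2 ≤ 4` is all that is needed.
    have hs2 : √(2 : ℝ) ≤ 2 := by nlinarith
    rw [Real.sqrt_mul zero_le_two, le_div_iff₀ (by positivity), hε]
    have h3 : (2 * L * (CG / √n) + c * √2 * √(Real.log (4 / δ)) / √n) * (√2 * √n)
        = 2 * √2 * (L * CG) + (√2 * √2) * c * √(Real.log (4 / δ)) := by
      field_simp
    rw [h3, hs]
    have := mul_le_mul_of_nonneg_right hs2 (mul_nonneg hL hCG)
    linarith
  obtain ⟨N₁, hN₁m, hN₁, h₁⟩ := exists_event_one_sided_deviation hn hX hind hlaw h𝒢 hsep hne hB hr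
    hL hφ hm hc.le hε0
  -- The lower tail is the upper tail of `-φ`, whose values lie in `[-(m + c), -m]`.
  obtain ⟨N₂, hN₂m, hN₂, h₂⟩ := exists_event_one_sided_deviation hn hX hind hlaw h𝒢 hsep hne hB hr
    (φ := fun z => -φ z) hL (fun z z' => by
      rw [← abs_neg]
      refine (le_of_eq ?_).trans (hφ z z')
      congr 1
      ring) (m := -(m + c)) (fun z hz => ⟨by linarith [(hm z hz).2], by linarith [(hm z hz).1]⟩)
    hc.le hε0
  refine ⟨N₁ ∪ N₂, hN₁m.union hN₂m, ?_, fun ω hω g hg => ?_⟩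
  · refine (measureReal_union_le _ _).trans ?_
    rw [htail] at hN₁ hN₂
    linarith
  · rw [Set.mem_union, not_or] at hω
    have e₁ := h₁ ω hω.1 g hg
    have e₂ := h₂ ω hω.2 g hg
    simp only [integral_neg, Finset.sum_neg_distrib, mul_neg] at e₂
    exact abs_le.2 ⟨by linarith, by linarith⟩

end UniformDeviation

lemma prior_one (p : ℝ) : prior p 1 = p := by simp [prior]

lemma prior_neg_one (p : ℝ) : prior p (-1) = 1 - p := by
  simp [prior, show ¬ (-1 : ℤˣ) = 1 by decide]

/-! ### Sensitivity of the empirical risk to the substituted prior. -/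

section PriorBias

variable {𝒳 : Type*}

lemma abs_weightedEmpRisk_sub_le {loss : ℝ → ℤˣ → ℝ} {Cl : ℝ} {n : ℕ} {z : Fin n → 𝒳 × 𝒳}
    {g : 𝒳 → ℝ} (hloss : ∀ x y, |loss (g x) y| ≤ Cl) (hn : 0 < n) (α β : ℤˣ → ℝ × ℝ) :
    |weightedEmpRisk α loss z g - weightedEmpRisk β loss z g| ≤
      Cl * ∑ t, (|(α t).1 - (β t).1| + |(α t).2 - (β t).2|) := by
  have hn' : (0 : ℝ) < n := Nat.cast_pos.2 hn
  rw [weightedEmpRisk, weightedEmpRisk, ← Finset.sum_sub_distrib, Finset.mul_sum]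
  refine (Finset.abs_sum_le_sum_abs _ _).trans (Finset.sum_le_sum fun t _ => ?_)
  rw [← mul_sub, ← Finset.sum_sub_distrib, abs_mul, abs_of_pos (by positivity), one_div,
    inv_mul_le_iff₀ hn']
  refine (Finset.abs_sum_le_sum_abs _ _).trans ((Finset.sum_le_sum
    (g := fun _ => Cl * (|(α t).1 - (β t).1| + |(α t).2 - (β t).2|)) fun i _ => ?_).trans
      (by simp))
  have h : ∀ u v : ℝ, (α t).1 * u + (α t).2 * v - ((β t).1 * u + (β t).2 * v)
      = ((α t).1 - (β t).1) * u + ((α t).2 - (β t).2) * v := fun u v => by ring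
  rw [h]
  refine (abs_add_le _ _).trans ?_
  rw [abs_mul, abs_mul, mul_add, mul_comm Cl, mul_comm Cl]
  exact add_le_add (mul_le_mul_of_nonneg_left (hloss _ _) (abs_nonneg _))
    (mul_le_mul_of_nonneg_left (hloss _ _) (abs_nonneg _))

/-- Both signs are allowed because the polynomials in `constS` and `constD` match the coefficient
differences for `t = 1` and their negatives for `t = -1`. -/
lemma abs_eq_abs_mul_of_mul_eq_or {x y u d e : ℝ} (hd : d ≠ 0) (he : e ≠ 0)
    (h : x * (d * e) = y * u ∨ x * (d * e) = -(y * u)) : |x| = |y| * (|u| / (|d| * |e|)) := by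
  rw [← mul_div_assoc, eq_div_iff (by positivity), ← abs_mul, ← abs_mul, ← abs_mul]
  exact abs_eq_abs.2 h

lemma sum_abs_alphaS_sub {p q : ℝ} (hp : p ≠ 1 / 2) (hq : q ≠ 1 / 2) :
    ∑ t, (|(alphaS q t).1 - (alphaS p t).1| + |(alphaS q t).2 - (alphaS p t).2|) =
      constS p q * (|q - p| /
        (|prior q 1 - prior q (-1)| * |prior p 1 - prior p (-1)|)) := by
  have hd : q - (1 - q) ≠ 0 := fun h => hq (by linarith)
  have he : p - (1 - p) ≠ 0 := fun h => hp (by linarith)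
  simp only [sum_units_int, alphaS, constS, prior_one, prior_neg_one, Prod.smul_mk,
    smul_eq_mul]
  rw [add_mul, add_mul, add_mul, add_assoc, add_assoc, add_assoc]
  refine congrArg₂ _ (abs_eq_abs_mul_of_mul_eq_or hd he (.inl ?_)) (congrArg₂ _
    (abs_eq_abs_mul_of_mul_eq_or hd he (.inl ?_)) (congrArg₂ _
    (abs_eq_abs_mul_of_mul_eq_or hd he (.inr ?_))
    (abs_eq_abs_mul_of_mul_eq_or hd he (.inr ?_))))
  all_goals
    field_simp
    ring

lemma sum_abs_alphaD_sub {p q : ℝ} (hp : p ≠ 1 / 2) (hq : q ≠ 1 / 2) :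
    ∑ t, (|(alphaD q t).1 - (alphaD p t).1| + |(alphaD q t).2 - (alphaD p t).2|) =
      constD p q * (|q - p| /
        (|prior q 1 - prior q (-1)| * |prior p 1 - prior p (-1)|)) := by
  have hd : q - (1 - q) ≠ 0 := fun h => hq (by linarith)
  have he : p - (1 - p) ≠ 0 := fun h => hp (by linarith)
  simp only [sum_units_int, alphaD, constD, prior_one, prior_neg_one, neg_neg, Prod.smul_mk,
    smul_eq_mul]
  rw [add_mul, add_mul, add_mul, add_assoc, add_assoc, add_assoc]
  refine congrArg₂ _ (abs_eq_abs_mul_of_mul_eq_or hd he (.inl ?_)) (congrArg₂ _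
    (abs_eq_abs_mul_of_mul_eq_or hd he (.inl ?_)) (congrArg₂ _
    (abs_eq_abs_mul_of_mul_eq_or hd he (.inr ?_))
    (abs_eq_abs_mul_of_mul_eq_or hd he (.inr ?_))))
  all_goals
    field_simp
    ring

/-- The effect on the empirical risk of substituting `q` for the positive prior `p`. -/
lemma two_mul_abs_empRisk_sub_le {loss : ℝ → ℤˣ → ℝ} {Cl : ℝ} {nS nD : ℕ}
    {zS : Fin nS → 𝒳 × 𝒳} {zD : Fin nD → 𝒳 × 𝒳} {g : 𝒳 → ℝ}
    (hloss : ∀ x y, |loss (g x) y| ≤ Cl) (hnS : 0 < nS) (hnD : 0 < nD) {p q : ℝ}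
    (hp : p ≠ 1 / 2) (hq : q ≠ 1 / 2) :
    2 * |empRisk q loss zS zD g - empRisk p loss zS zD g| ≤ priorBias p q Cl := by
  have hS := abs_weightedEmpRisk_sub_le (z := zS) hloss hnS (alphaS q) (alphaS p)
  have hD := abs_weightedEmpRisk_sub_le (z := zD) hloss hnD (alphaD q) (alphaD p)
  rw [sum_abs_alphaS_sub hp hq] at hS
  rw [sum_abs_alphaD_sub hp hq] at hD
  rw [priorBias, mul_div_assoc]
  refine mul_le_mul_of_nonneg_left ?_ zero_le_two
  rw [empRisk, empRisk, add_sub_add_comm, mul_add, add_mul]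
  refine (abs_add_le _ _).trans ?_
  linarith

end PriorBias

/-! ### Unbiasedness of the estimator at the true prior. -/

section Unbiased

/-- The loss combination `π_+ ℓ(z, +1) - π_- ℓ(z, -1)` weighting the similar pairs. -/
def lossS (p : ℝ) (loss : ℝ → ℤˣ → ℝ) (z : ℝ) : ℝ :=
  p * loss z 1 - (1 - p) * loss z (-1)

/-- The loss combination `π_- ℓ(z, +1) - π_+ ℓ(z, -1)` weighting the dissimilar pairs. -/
def lossD (p : ℝ) (loss : ℝ → ℤˣ → ℝ) (z : ℝ) : ℝ := lossS (1 - p) loss z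

variable {𝒳 : Type*}

lemma weightedEmpRisk_alphaS (p : ℝ) (loss : ℝ → ℤˣ → ℝ) {n : ℕ} (z : Fin n → 𝒳 × 𝒳)
    (g : 𝒳 → ℝ) :
    weightedEmpRisk (alphaS p) loss z g = ∑ t, prior p t ^ 2 / (prior p 1 - prior p (-1)) *
      ((1 / n : ℝ) * ∑ i, lossS p loss (g (component t (z i)))) := by
  refine Finset.sum_congr rfl fun t _ => ?_
  rw [mul_left_comm]
  congr 1
  rw [Finset.mul_sum]
  refine Finset.sum_congr rfl fun i _ => ?_
  simp only [alphaS, lossS, Prod.smul_mk, smul_eq_mul, prior_one, prior_neg_one]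
  ring

lemma weightedEmpRisk_alphaD (p : ℝ) (loss : ℝ → ℤˣ → ℝ) {n : ℕ} (z : Fin n → 𝒳 × 𝒳)
    (g : 𝒳 → ℝ) :
    weightedEmpRisk (alphaD p) loss z g =
      ∑ t, (prior p t ^ 2 - prior p (-t)) / (prior p 1 - prior p (-1)) *
        ((1 / n : ℝ) * ∑ i, lossD p loss (g (component t (z i)))) := by
  refine Finset.sum_congr rfl fun t _ => ?_
  rw [mul_left_comm]
  congr 1
  rw [Finset.mul_sum]
  refine Finset.sum_congr rfl fun i _ => ?_
  simp only [alphaD, lossD, lossS, Prod.smul_mk, smul_eq_mul, prior_one, prior_neg_one]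
  ring

lemma lossS_lipschitz {p : ℝ} (hp : p ∈ Set.Icc (0 : ℝ) 1) {loss : ℝ → ℤˣ → ℝ} {L : ℝ}
    (h : ∀ y z z', |loss z y - loss z' y| ≤ L * |z - z'|) (z z' : ℝ) :
    |lossS p loss z - lossS p loss z'| ≤ L * |z - z'| := by
  have h1 := abs_le.1 (h 1 z z')
  have h2 := abs_le.1 (h (-1) z z')
  have hp0 := hp.1
  have hp1 : 0 ≤ 1 - p := by linarith [hp.2]
  unfold lossS
  exact abs_le.2 ⟨by nlinarith, by nlinarith⟩

/-- The interval has length `Cl`, not `2 * Cl`, because the weights `p` and `1 - p` sum to one. -/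
lemma lossS_mem {p : ℝ} (hp : p ∈ Set.Icc (0 : ℝ) 1) {loss : ℝ → ℤˣ → ℝ} {Cl z : ℝ}
    (h0 : ∀ y, 0 ≤ loss z y) (h : ∀ y, loss z y ≤ Cl) :
    -((1 - p) * Cl) ≤ lossS p loss z ∧ lossS p loss z ≤ -((1 - p) * Cl) + Cl := by
  have hp0 := hp.1
  have hp1 : 0 ≤ 1 - p := by linarith [hp.2]
  have h1 := mul_le_mul_of_nonneg_left (h 1) hp0
  have h2 := mul_le_mul_of_nonneg_left (h (-1)) hp1
  have h3 := mul_nonneg hp0 (h0 1)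
  have h4 := mul_nonneg hp1 (h0 (-1))
  unfold lossS
  constructor <;> linarith

lemma label_compl :
    (Prod.snd ⁻¹' {1} : Set (𝒳 × ℤˣ))ᶜ = Prod.snd ⁻¹' {(-1 : ℤˣ)} := by
  ext z
  rcases Int.units_eq_one_or z.2 with h | h <;> simp [h]

variable [MeasurableSpace 𝒳]

lemma posPrior_mem_Icc (D : Measure (𝒳 × ℤˣ)) [IsProbabilityMeasure D] :
    posPrior D ∈ Set.Icc (0 : ℝ) 1 := ⟨measureReal_nonneg, measureReal_le_one⟩

lemma measurableSet_label (y : ℤˣ) : MeasurableSet (Prod.snd ⁻¹' {y} : Set (𝒳 × ℤˣ)) :=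
  measurable_snd (measurableSet_singleton y)

lemma measureReal_label (D : Measure (𝒳 × ℤˣ)) [IsProbabilityMeasure D] (y : ℤˣ) :
    D.real (Prod.snd ⁻¹' {y}) = prior (posPrior D) y := by
  rcases Int.units_eq_one_or y with rfl | rfl
  · rw [prior_one, posPrior]
  · rw [prior_neg_one, posPrior, ← label_compl, measureReal_compl (measurableSet_label 1)]
    simp

instance (D : Measure (𝒳 × ℤˣ)) [IsFiniteMeasure D] (y : ℤˣ) :
    IsFiniteMeasure (classCond D y) := by
  unfold classCond
  infer_instance

lemma setIntegral_label (D : Measure (𝒳 × ℤˣ)) [IsProbabilityMeasure D] (y : ℤˣ)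
    {h : 𝒳 → ℝ} (hh : Measurable h) :
    ∫ z in Prod.snd ⁻¹' {y}, h z.1 ∂D =
      prior (posPrior D) y * ∫ x, h x ∂(classCond D y) := by
  rw [classCond, integral_map measurable_fst.aemeasurable hh.aestronglyMeasurable,
    ProbabilityTheory.cond,
    integral_smul_measure, smul_eq_mul, ← measureReal_label, ← mul_assoc, ENNReal.toReal_inv]
  -- A class of prior zero contributes nothing to either side, whatever its conditional law.
  by_cases h0 : D.real (Prod.snd ⁻¹' {y}) = 0
  · have : D (Prod.snd ⁻¹' {y}) = 0 := (measureReal_eq_zero_iff).1 h0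
    rw [h0, Measure.restrict_eq_zero.2 this]
    simp
  · rw [← measureReal_def, mul_inv_cancel₀ h0, one_mul]

lemma risk_eq (D : Measure (𝒳 × ℤˣ)) [IsProbabilityMeasure D] {loss : ℝ → ℤˣ → ℝ} {g : 𝒳 → ℝ}
    (hm : ∀ y, Measurable fun x => loss (g x) y) {Cl : ℝ} (hb : ∀ x y, |loss (g x) y| ≤ Cl) :
    risk D loss g = ∑ y, prior (posPrior D) y * ∫ x, loss (g x) y ∂(classCond D y) := by
  have hmeas : Measurable fun z : 𝒳 × ℤˣ => loss (g z.1) z.2 :=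
    measurable_from_prod_countable_left fun y => hm y
  rw [risk, ← integral_add_compl (measurableSet_label 1)
    (integrable_of_abs_le hmeas fun z => hb _ _), label_compl, sum_units_int]
  have h : ∀ y : ℤˣ, ∫ z in Prod.snd ⁻¹' {y}, loss (g z.1) z.2 ∂D
      = prior (posPrior D) y * ∫ x, loss (g x) y ∂(classCond D y) := fun y => by
    rw [← setIntegral_label D y (hm y)]
    refine setIntegral_congr_fun (measurableSet_label y) fun z hz => ?_
    rw [Set.mem_preimage, Set.mem_singleton_iff] at hz
    simp only [hz]
  rw [h, h]

lemma integral_pcompLaw (D : Measure (𝒳 × ℤˣ)) [IsProbabilityMeasure D] (t : ℤˣ)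
    {h : 𝒳 → ℝ} (hm : Measurable h) {B : ℝ} (hB : ∀ x, |h x| ≤ B) :
    ∫ x, h x ∂(pcompLaw D t) =
      prior (posPrior D) t / (prior (posPrior D) (-t) ^ 2 + prior (posPrior D) t) *
          ∫ x, h x ∂(classCond D t) +
        prior (posPrior D) (-t) ^ 2 / (prior (posPrior D) (-t) ^ 2 + prior (posPrior D) t) *
          ∫ x, h x ∂(classCond D (-t)) := by
  have h0 : ∀ y, 0 ≤ prior (posPrior D) y := fun y => by
    rw [← measureReal_label]
    exact measureReal_nonneg
  have hi : ∀ y, Integrable h (classCond D y) := fun y => integrable_of_abs_le hm hB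
  have ht := h0 t
  rw [pcompLaw, integral_add_measure ((hi _).smul_measure ENNReal.ofReal_ne_top)
    ((hi _).smul_measure ENNReal.ofReal_ne_top), integral_smul_measure, integral_smul_measure,
    ENNReal.toReal_ofReal (by positivity), ENNReal.toReal_ofReal (by positivity)]
  simp only [smul_eq_mul]

/-- The SD-Pcomp risk with the true priors is the classification risk. -/
lemma risk_eq_pcomp (D : Measure (𝒳 × ℤˣ)) [IsProbabilityMeasure D]
    (hprior : posPrior D ≠ 1 / 2) {loss : ℝ → ℤˣ → ℝ} {g : 𝒳 → ℝ}
    (hm : ∀ y, Measurable fun x => loss (g x) y) {Cl : ℝ} (hb : ∀ x y, |loss (g x) y| ≤ Cl) :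
    risk D loss g =
      (∑ t, prior (posPrior D) t ^ 2 / (prior (posPrior D) 1 - prior (posPrior D) (-1)) *
        ∫ x, lossS (posPrior D) loss (g x) ∂(pcompLaw D t)) +
      ∑ t, (prior (posPrior D) t ^ 2 - prior (posPrior D) (-t)) /
          (prior (posPrior D) 1 - prior (posPrior D) (-1)) *
        ∫ x, lossD (posPrior D) loss (g x) ∂(pcompLaw D t) := by
  have hS : ∀ (p : ℝ) (y : ℤˣ), ∫ x, lossS p loss (g x) ∂(classCond D y)
      = p * ∫ x, loss (g x) 1 ∂(classCond D y)
        - (1 - p) * ∫ x, loss (g x) (-1) ∂(classCond D y) := fun p y => by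
    have hi : ∀ u, Integrable (fun x => loss (g x) u) (classCond D y) := fun u =>
      integrable_of_abs_le (hm u) fun x => hb x u
    simp only [lossS]
    rw [integral_sub ((hi 1).const_mul p) ((hi (-1)).const_mul (1 - p)),
      integral_const_mul, integral_const_mul]
  have hSm : ∀ p, Measurable fun x => lossS p loss (g x) := fun p =>
    ((hm 1).const_mul p).sub ((hm (-1)).const_mul (1 - p))
  have hSb : ∀ p x, |lossS p loss (g x)| ≤ |p| * Cl + |1 - p| * Cl := fun p x => by
    refine (abs_sub _ _).trans ?_
    rw [abs_mul, abs_mul]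
    exact add_le_add (mul_le_mul_of_nonneg_left (hb _ _) (abs_nonneg _))
      (mul_le_mul_of_nonneg_left (hb _ _) (abs_nonneg _))
  rw [risk_eq D hm hb]
  simp only [lossD, sum_units_int, integral_pcompLaw D _ (hSm _) (hSb _), hS, prior_one,
    prior_neg_one, neg_neg]
  set p := posPrior D with hp
  have hd : p - (1 - p) ≠ 0 := fun h => hprior (by linarith)
  -- Both normalizers equal `(p - 1/2)² + 3/4`; once identified, they cancel as a common factor.
  have he : (1 - p) ^ 2 + p ≠ 0 := by nlinarith [sq_nonneg (p - 1 / 2)]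
  have hf : p ^ 2 + (1 - p) ≠ 0 := by nlinarith [sq_nonneg (p - 1 / 2)]
  have hef : p ^ 2 + (1 - p) = (1 - p) ^ 2 + p := by ring
  rw [hef]
  field_simp
  ring

end Unbiased

/-! ### Sample error at the true prior, by a union bound. -/

section SampleError

variable {𝒳 : Type*} [MeasurableSpace 𝒳]

lemma measurable_component (t : ℤˣ) : Measurable (component t : 𝒳 × 𝒳 → 𝒳) := by
  rcases Int.units_eq_one_or t with rfl | rfl
  · exact measurable_fst
  · exact measurable_snd

lemma IsPcompSample.map_component {Ω : Type*} [MeasurableSpace Ω] {D : Measure (𝒳 × ℤˣ)}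
    {P : Measure Ω} {n : ℕ} {X : Fin n → Ω → 𝒳 × 𝒳} (hX : IsPcompSample D P X) (t : ℤˣ)
    (i : Fin n) : P.map (fun ω => component t (X i ω)) = pcompLaw D t := by
  rcases Int.units_eq_one_or t with rfl | rfl
  · exact hX.law_fst i
  · exact hX.law_snd i

lemma abs_sum_mul_sub_le {α u v : ℤˣ → ℝ} {r : ℝ} (h : ∀ t, |u t - v t| ≤ r) :
    |∑ t, α t * u t - ∑ t, α t * v t| ≤ (∑ t, |α t|) * r := by
  rw [← Finset.sum_sub_distrib, Finset.sum_mul]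
  refine (Finset.abs_sum_le_sum_abs _ _).trans (Finset.sum_le_sum fun t _ => ?_)
  rw [← mul_sub, abs_mul]
  exact mul_le_mul_of_nonneg_left (h t) (abs_nonneg _)

lemma sampleError_eq (p L CG Cl δ : ℝ) (nS nD : ℕ) :
    sampleError p L CG Cl δ nS nD =
      (∑ t, |prior p t ^ 2 / (prior p 1 - prior p (-1))|) *
          ((4 * L * CG + 2 * Cl * √(Real.log (4 / δ))) / √(2 * nS)) +
        (∑ t, |(prior p t ^ 2 - prior p (-t)) / (prior p 1 - prior p (-1))|) *
          ((4 * L * CG + 2 * Cl * √(Real.log (4 / δ))) / √(2 * nD)) := by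
  simp only [sampleError, constGLD, sum_units_int, neg_neg, abs_div, abs_sq]
  rw [abs_sub_comm (prior p (-1) ^ 2) (prior p 1)]
  ring

lemma eight_mul_pow_four_le {δ : ℝ} (h0 : 0 < δ) (h1 : δ ≤ 1) : 8 * (δ / 4) ^ 4 ≤ δ := by
  have h : δ ^ 3 ≤ 1 := pow_le_one₀ h0.le h1
  nlinarith

/-- Uniform deviation of the SD-Pcomp empirical risk with the true priors from the risk. -/
lemma exists_event_abs_risk_sub_empRisk_le
    (D : Measure (𝒳 × ℤˣ)) [IsProbabilityMeasure D] (hprior : posPrior D ≠ 1 / 2)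
    {loss : ℝ → ℤˣ → ℝ} (hloss_nonneg : ∀ z y, 0 ≤ loss z y)
    {L : ℝ} (hloss_lip : ∀ y z z', |loss z y - loss z' y| ≤ L * |z - z'|)
    {𝒢 : Set (𝒳 → ℝ)} (h𝒢_meas : ∀ g ∈ 𝒢, Measurable g) (h𝒢_sep : PointwiseSeparable 𝒢)
    (h𝒢_ne : 𝒢.Nonempty) {Cg : ℝ} (hCg : ∀ g ∈ 𝒢, ∀ x, |g x| ≤ Cg)
    {Cl : ℝ} (hCl : ∀ z y, |z| ≤ Cg → loss z y ≤ Cl) {CG : ℝ}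
    (hCG : ∀ n : ℕ, 0 < n → ∀ t : ℤˣ, rademacherComplexity 𝒢 n (pcompLaw D t) ≤ CG / √n)
    {Ω : Type*} [MeasurableSpace Ω] (P : Measure Ω) [IsProbabilityMeasure P]
    {nS nD : ℕ} (hnS : 0 < nS) (hnD : 0 < nD)
    {XS : Fin nS → Ω → 𝒳 × 𝒳} (hXS : IsPcompSample D P XS)
    {XD : Fin nD → Ω → 𝒳 × 𝒳} (hXD : IsPcompSample D P XD)
    {δ : ℝ} (hδ : 0 < δ) (hδ1 : δ ≤ 1) :
    ∃ A : Set Ω, MeasurableSet A ∧ ENNReal.ofReal (1 - δ) ≤ P A ∧ ∀ ω ∈ A, ∀ g ∈ 𝒢,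
      |risk D loss g - empRisk (posPrior D) loss (fun i => XS i ω) (fun i => XD i ω) g| ≤
        sampleError (posPrior D) L CG Cl δ nS nD := by
  set p := posPrior D with hp
  have hpI : p ∈ Set.Icc (0 : ℝ) 1 := posPrior_mem_Icc D
  have hpI' : 1 - p ∈ Set.Icc (0 : ℝ) 1 := ⟨by linarith [hpI.2], by linarith [hpI.1]⟩
  have hL : 0 ≤ L := by
    have := (abs_nonneg _).trans (hloss_lip 1 1 0)
    simpa using this
  obtain ⟨x₀⟩ : Nonempty (𝒳 × ℤˣ) := nonempty_of_isProbabilityMeasure D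
  have hCl0 : 0 ≤ Cl := by
    obtain ⟨g, hg⟩ := h𝒢_ne
    exact (hloss_nonneg (g x₀.1) 1).trans (hCl _ _ (hCg g hg x₀.1))
  have hev : ∀ {n : ℕ} (_ : 0 < n) {X : Fin n → Ω → 𝒳 × 𝒳} (_ : IsPcompSample D P X) {q : ℝ}
      (_ : q ∈ Set.Icc (0 : ℝ) 1) (t : ℤˣ),
      ∃ N : Set Ω, MeasurableSet N ∧ P.real N ≤ 2 * (δ / 4) ^ 4 ∧ ∀ ω, ω ∉ N → ∀ g ∈ 𝒢,
        |(∫ y, lossS q loss (g y) ∂(pcompLaw D t)) -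
            (1 / n : ℝ) * ∑ i, lossS q loss (g (component t (X i ω)))| ≤
          (4 * L * CG + 2 * Cl * √(Real.log (4 / δ))) / √(2 * n) :=
    fun {n} hn {X} hX {q} hq t =>
      exists_event_uniform_deviation (X := fun i ω => component t (X i ω)) hn
        (fun i => (measurable_component t).comp (hX.measurable i))
        (hX.indep.comp (fun _ => component t) fun _ => measurable_component t)
        (hX.map_component t) h𝒢_meas h𝒢_sep h𝒢_ne hCg (hCG n hn t) hL
        (lossS_lipschitz hq hloss_lip)
        (fun z hz => lossS_mem hq (hloss_nonneg z) fun y => hCl z y hz) hCl0 hδ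
        (by linarith)
  choose NS hNSm hNS hS using hev hnS hXS hpI
  choose ND hNDm hND hD using hev hnD hXD hpI'
  -- Four means with two tails each cost `8 * (δ / 4) ^ 4`, which is at most `δ` since `δ ≤ 1`.
  set N : Set Ω := (NS 1 ∪ NS (-1)) ∪ (ND 1 ∪ ND (-1)) with hN
  have hNm : MeasurableSet N :=
    ((hNSm 1).union (hNSm (-1))).union ((hNDm 1).union (hNDm (-1)))
  have hNP : P.real N ≤ δ := by
    have h1 := measureReal_union_le (μ := P) (NS 1 ∪ NS (-1)) (ND 1 ∪ ND (-1))
    have h2 := measureReal_union_le (μ := P) (NS 1) (NS (-1))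
    have h3 := measureReal_union_le (μ := P) (ND 1) (ND (-1))
    linarith [hNS 1, hNS (-1), hND 1, hND (-1), eight_mul_pow_four_le hδ hδ1]
  refine ⟨Nᶜ, hNm.compl, ?_, fun ω hω g hg => ?_⟩
  · refine ENNReal.ofReal_le_of_le_toReal ?_
    rw [← measureReal_def, measureReal_compl hNm, probReal_univ]
    linarith
  · have hωS : ∀ t, ω ∉ NS t := fun t ht => hω (by
      rcases Int.units_eq_one_or t with rfl | rfl
      · exact Or.inl (Or.inl ht)
      · exact Or.inl (Or.inr ht))
    have hωD : ∀ t, ω ∉ ND t := fun t ht => hω (by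
      rcases Int.units_eq_one_or t with rfl | rfl
      · exact Or.inr (Or.inl ht)
      · exact Or.inr (Or.inr ht))
    have hmeas : ∀ y, Measurable fun x => loss (g x) y := fun y => by
      have hc : Continuous fun z => loss z y :=
        (LipschitzWith.of_dist_le_mul (K := ⟨L, hL⟩) fun z z' => by
          rw [Real.dist_eq, Real.dist_eq]
          exact hloss_lip y z z').continuous
      exact hc.measurable.comp (h𝒢_meas g hg)
    have hb : ∀ x y, |loss (g x) y| ≤ Cl := fun x y => by
      rw [abs_of_nonneg (hloss_nonneg _ _)]
      exact hCl _ _ (hCg g hg x)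
    rw [risk_eq_pcomp D hprior hmeas hb, empRisk, weightedEmpRisk_alphaS, weightedEmpRisk_alphaD,
      sampleError_eq, add_sub_add_comm]
    exact (abs_add_le _ _).trans (add_le_add
      (abs_sum_mul_sub_le fun t => hS t ω (hωS t) g hg)
      (abs_sum_mul_sub_le fun t => hD t ω (hωD t) g hg))

end SampleError

end SDPcomp

/-! ### The excess risk bound. -/

theorem theorem5
    {𝒳 : Type*} [MeasurableSpace 𝒳]
    -- the joint law of `(x, y)`; the priors `π_+`, `π_-` differ
    (D : Measure (𝒳 × ℤˣ)) [IsProbabilityMeasure D]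
    (hprior : posPrior D ≠ 1 / 2)
    -- the loss: non-negative and Lipschitz
    (loss : ℝ → ℤˣ → ℝ) (hloss_nonneg : ∀ z y, 0 ≤ loss z y)
    (L : ℝ) (hloss_lip : ∀ y z z', |loss z y - loss z' y| ≤ L * |z - z'|)
    -- the class of decision functions, uniformly bounded by `Cg`, with loss bounded by `Cl`
    (𝒢 : Set (𝒳 → ℝ)) (h𝒢_meas : ∀ g ∈ 𝒢, Measurable g) (h𝒢_sep : PointwiseSeparable 𝒢)
    (Cg : ℝ) (hCg : ∀ g ∈ 𝒢, ∀ x, |g x| ≤ Cg)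
    (Cl : ℝ) (hCl : ∀ z y, |z| ≤ Cg → loss z y ≤ Cl)
    -- `CG` is the constant in the `1 / √n` decay of the Rademacher complexity of `𝒢`
    (CG : ℝ)
    (hCG : ∀ n : ℕ, 0 < n → ∀ t : ℤˣ, rademacherComplexity 𝒢 n (pcompLaw D t) ≤ CG / √n)
    -- a minimizer of the risk over `𝒢`
    (gstar : 𝒳 → ℝ) (hgstar_mem : gstar ∈ 𝒢) (hgstar_min : IsMinOn (risk D loss) 𝒢 gstar)
    -- the similar and the dissimilar pairs
    {Ω : Type*} [MeasurableSpace Ω] (P : Measure Ω) [IsProbabilityMeasure P]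
    {nS nD : ℕ} (hnS : 0 < nS) (hnD : 0 < nD)
    (XS : Fin nS → Ω → 𝒳 × 𝒳) (hXS : IsPcompSample D P XS)
    (XD : Fin nD → Ω → 𝒳 × 𝒳) (hXD : IsPcompSample D P XD)
    (δ : ℝ) (hδ : 0 < δ) :
    -- an event of probability at least `1 - δ`, on which the bound holds for every value `q`
    -- of the estimated positive prior and every empirical risk minimizer computed with `q`
    ∃ A : Set Ω, MeasurableSet A ∧ ENNReal.ofReal (1 - δ) ≤ P A ∧
      ∀ ω ∈ A, ∀ q ∈ Set.Icc (0 : ℝ) 1, q ≠ 1 / 2 →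
        ∀ ghat ∈ 𝒢,
          IsMinOn (empRisk q loss (fun i => XS i ω) (fun i => XD i ω)) 𝒢 ghat →
          risk D loss ghat - risk D loss gstar ≤
            2 * sampleError (posPrior D) L CG Cl δ nS nD + priorBias (posPrior D) q Cl := by
  rcases lt_or_ge 1 δ with hδ1 | hδ1
  · refine ⟨∅, MeasurableSet.empty, ?_, by simp⟩
    rw [ENNReal.ofReal_of_nonpos (by linarith)]
    exact zero_le
  · obtain ⟨A, hAm, hA, hdev⟩ := exists_event_abs_risk_sub_empRisk_le D hprior hloss_nonneg
      hloss_lip h𝒢_meas h𝒢_sep ⟨gstar, hgstar_mem⟩ hCg hCl hCG P hnS hnD hXS hXD hδ hδ1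
    -- The event `A` concerns the true prior only and is fixed before `q`. Deviation and bias are
    -- each used once at `ghat` and once at `gstar`; the factor 2 in `priorBias` covers both uses of
    -- the bias.
    refine ⟨A, hAm, hA, fun ω hω q _ hq ghat hghat hmin => ?_⟩
    have hbias : ∀ g ∈ 𝒢, 2 * |empRisk q loss (fun i => XS i ω) (fun i => XD i ω) g -
        empRisk (posPrior D) loss (fun i => XS i ω) (fun i => XD i ω) g| ≤
          priorBias (posPrior D) q Cl := fun g hg => by
      refine two_mul_abs_empRisk_sub_le (fun x y => ?_) hnS hnD hprior hq
      rw [abs_of_nonneg (hloss_nonneg _ _)]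
      exact hCl _ _ (hCg g hg x)
    have hle : empRisk q loss (fun i => XS i ω) (fun i => XD i ω) ghat ≤
        empRisk q loss (fun i => XS i ω) (fun i => XD i ω) gstar := hmin hgstar_mem
    have h1 := abs_le.1 (hdev ω hω ghat hghat)
    have h2 := abs_le.1 (hdev ω hω gstar hgstar_mem)
    have h3 := neg_abs_le (empRisk q loss (fun i => XS i ω) (fun i => XD i ω) ghat -
      empRisk (posPrior D) loss (fun i => XS i ω) (fun i => XD i ω) ghat)
    have h4 := le_abs_self (empRisk q loss (fun i => XS i ω) (fun i => XD i ω) gstar -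
      empRisk (posPrior D) loss (fun i => XS i ω) (fun i => XD i ω) gstar)
    linarith [hbias ghat hghat, hbias gstar hgstar_mem]
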